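/- A vector-matrix-vector query to an unknown real symmetric matrix $A\in\mathbb{R}^{d\times d}$ consists of a pair $(v,w)$ of vectors in $\mathbb{R}^d$ and is answered by $v^TAw$. A randomized algorithm is non-adaptive if its queries depend only on its random seed; it uses one additional round of adaptivity if a second batch of queries may also depend on the answers to a first, non-adaptive batch. Queries and outputs are Borel measurable functions, jointly in the seed and the answers on which they depend; only queries are counted. There is an absolute constant $C>0$ such that the following holds for all integers $1\le k\le d$ and all $0<\epsilon<1$. For a real symmetric $d\times d$ matrix $A$, let $\lambda_1,\dots,\lambda_d$ be its signed eigenvalues with multiplicity, sorted so that $|\lambda_1|\ge|\lambda_2|\ge\dots\ge|\lambda_d|$ (ties in any order), and let $\|A\|_F$ be its Frobenius norm. There is a randomized non-adaptive algorithm making at most $C\,\frac{k^2}{\epsilon^{12}}\log(k+1)$ vector-matrix-vector queries which, for every real symmetric $d\times d$ matrix $A$, with probability at least $0.9$ outputs $\tilde\lambda_1,\dots,\tilde\lambda_k\in\mathbb{R}$ such that (i) there exists a permutation $\sigma$ of $\{1,\dots,k\}$ such that $|\tilde\lambda_{\sigma(i)}-\lambda_i|\le\epsilon\|A\|_F$ for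 all $i\in\{1,\dots,k\}$ with $|\lambda_i|\ge|\lambda_k|+2\epsilon\|A\|_F$; and (ii) for every $i\in\{1,\dots,k\}$ there exists $j\in\{1,\dots,d\}$ with $|\lambda_j|\ge|\lambda_k|-\epsilon\|A\|_F$ and $|\tilde\lambda_i-\lambda_j|\le\epsilon\|A\|_F$. With one additional round of adaptivity, there is an algorithm with the same guarantee that makes at most $C\,\frac{k^2}{\epsilon^{8}}\log(k+1)$ vector-matrix-vector queries in total. -/

import Mathlib

open MeasureTheory
open scoped Matrix

noncomputable section

/-- The Frobenius norm `‖A‖_F = (∑ A_{ij}²)^{1/2}` of a real matrix (Mathlib's Frobenius norm). -/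
def frobNorm {d : ℕ} (A : Matrix (Fin d) (Fin d) ℝ) : ℝ :=
  @norm _ Matrix.frobeniusNormedAddCommGroup.toNorm A

/-- The answer `vᵀ A w` to the vector-matrix-vector query `(v, w)`. -/
def vmvAnswer {d : ℕ} (A : Matrix (Fin d) (Fin d) ℝ) (v w : Fin d → ℝ) : ℝ :=
  v ⬝ᵥ (A *ᵥ w)

/-- `lam` lists the eigenvalues of the real symmetric matrix `A`, with multiplicity,
in decreasing order of magnitude (ties may be ordered in any way). -/
structure IsSpectrumByMagnitude {d : ℕ} {A : Matrix (Fin d) (Fin d) ℝ} (hA : A.IsHermitian)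
    (lam : Fin d → ℝ) : Prop where
  enumerates : ∃ e : Equiv.Perm (Fin d), lam = hA.eigenvalues ∘ e
  antitone_abs : Antitone fun i => |lam i|

/-- A randomized non-adaptive algorithm that makes `q` vector-matrix-vector queries to a
`d × d` matrix and outputs `k` real numbers. The queries depend on the random seed only; the output
is computed from the seed and the answers. Both are Borel functions of the data they
depend on (jointly in seed and answers); otherwise arbitrary computation is free. -/
structure NonadaptiveVMV (d k q : ℕ) where
  /-- The space of random seeds. -/
  Seed : Type
  [instMeasurableSpace : MeasurableSpace Seed]
  /-- The distribution of the random seed. -/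
  law : Measure Seed
  [instIsProbabilityMeasure : IsProbabilityMeasure law]
  /-- The left vectors of the queries. -/
  left : Seed → Fin q → Fin d → ℝ
  /-- The right vectors of the queries. -/
  right : Seed → Fin q → Fin d → ℝ
  /-- The output, from the seed and the answers. -/
  output : Seed × (Fin q → ℝ) → Fin k → ℝ
  measurable_left : Measurable left
  measurable_right : Measurable right
  measurable_output : Measurable output

/-- The output of a non-adaptive algorithm on the matrix `A` with random seed `s`. -/
def NonadaptiveVMV.run {d k q : ℕ} (alg : NonadaptiveVMV d k q) (A : Matrix (Fin d) (Fin d) ℝ)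
    (s : alg.Seed) : Fin k → ℝ :=
  alg.output (s, fun j => vmvAnswer A (alg.left s j) (alg.right s j))

/-- A randomized algorithm with one additional round of adaptivity: it makes `q₁`
vector-matrix-vector queries that depend on the random seed only, then `q₂` further queries that
depend on the seed and on the answers of the first round, and outputs `k` real numbers
computed from the seed and all `q₁ + q₂` answers. -/
structure TwoRoundVMV (d k q₁ q₂ : ℕ) where
  /-- The space of random seeds. -/
  Seed : Type
  [instMeasurableSpace : MeasurableSpace Seed]
  /-- The distribution of the random seed. -/
  law : Measure Seed
  [instIsProbabilityMeasure : IsProbabilityMeasure law]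
  /-- The left vectors of the first round of queries. -/
  left₁ : Seed → Fin q₁ → Fin d → ℝ
  /-- The right vectors of the first round of queries. -/
  right₁ : Seed → Fin q₁ → Fin d → ℝ
  /-- The left vectors of the second round of queries. -/
  left₂ : Seed × (Fin q₁ → ℝ) → Fin q₂ → Fin d → ℝ
  /-- The right vectors of the second round of queries. -/
  right₂ : Seed × (Fin q₁ → ℝ) → Fin q₂ → Fin d → ℝ
  /-- The output, from the seed and the answers of both rounds. -/
  output : Seed × (Fin q₁ → ℝ) × (Fin q₂ → ℝ) → Fin k → ℝ
  measurable_left₁ : Measurable left₁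
  measurable_right₁ : Measurable right₁
  measurable_left₂ : Measurable left₂
  measurable_right₂ : Measurable right₂
  measurable_output : Measurable output

/-- The answers that a two-round algorithm receives in its first round. -/
def TwoRoundVMV.answers₁ {d k q₁ q₂ : ℕ} (alg : TwoRoundVMV d k q₁ q₂)
    (A : Matrix (Fin d) (Fin d) ℝ) (s : alg.Seed) : Fin q₁ → ℝ :=
  fun j => vmvAnswer A (alg.left₁ s j) (alg.right₁ s j)

/-- The answers that a two-round algorithm receives in its second round. -/
def TwoRoundVMV.answers₂ {d k q₁ q₂ : ℕ} (alg : TwoRoundVMV d k q₁ q₂)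
    (A : Matrix (Fin d) (Fin d) ℝ) (s : alg.Seed) : Fin q₂ → ℝ :=
  fun j => vmvAnswer A (alg.left₂ (s, alg.answers₁ A s) j) (alg.right₂ (s, alg.answers₁ A s) j)

/-- The output of a two-round algorithm on the matrix `A` with random seed `s`. -/
def TwoRoundVMV.run {d k q₁ q₂ : ℕ} (alg : TwoRoundVMV d k q₁ q₂)
    (A : Matrix (Fin d) (Fin d) ℝ) (s : alg.Seed) : Fin k → ℝ :=
  alg.output (s, alg.answers₁ A s, alg.answers₂ A s)

/-- The accuracy guarantee for estimates `est` of the top `k` eigenvalues, where `lam` lists the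
eigenvalues by decreasing magnitude and `F` is the Frobenius norm of the matrix.
Indices start at `0`, so that the `k`-th eigenvalue is `lam ⟨k - 1, _⟩`. -/
structure AccurateTopEigenvalues {d k : ℕ} (hk : 1 ≤ k) (hkd : k ≤ d) (ε F : ℝ)
    (lam : Fin d → ℝ) (est : Fin k → ℝ) : Prop where
  /-- Up to a permutation, every well separated top eigenvalue is approximated. -/
  separated : ∃ σ : Equiv.Perm (Fin k), ∀ i : Fin k,
    |lam ⟨k - 1, by omega⟩| + 2 * ε * F ≤ |lam (Fin.castLE hkd i)| →
      |est (σ i) - lam (Fin.castLE hkd i)| ≤ ε * F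
  /-- Every estimate is close to some eigenvalue of large magnitude. -/
  sound : ∀ i : Fin k, ∃ j : Fin d,
    |lam ⟨k - 1, by omega⟩| - ε * F ≤ |lam j| ∧ |est i - lam j| ≤ ε * F

/-- For every symmetric input matrix, the non-adaptive algorithm outputs accurate signed estimates
of its top `k` eigenvalues with probability at least `9/10`. -/
def NonadaptiveVMV.ApproximatesTopEigenvalues {d k q : ℕ} (alg : NonadaptiveVMV d k q)
    (hk : 1 ≤ k) (hkd : k ≤ d) (ε : ℝ) : Prop :=
  ∀ (A : Matrix (Fin d) (Fin d) ℝ) (hA : A.IsHermitian) (lam : Fin d → ℝ),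
    IsSpectrumByMagnitude hA lam →
      9 / 10 ≤ (@Measure.real alg.Seed alg.instMeasurableSpace alg.law
        {s | AccurateTopEigenvalues hk hkd ε (frobNorm A) lam (alg.run A s)})

/-- For every symmetric input matrix, the two-round algorithm outputs accurate signed estimates
of its top `k` eigenvalues with probability at least `9/10`. -/
def TwoRoundVMV.ApproximatesTopEigenvalues {d k q₁ q₂ : ℕ} (alg : TwoRoundVMV d k q₁ q₂)
    (hk : 1 ≤ k) (hkd : k ≤ d) (ε : ℝ) : Prop :=
  ∀ (A : Matrix (Fin d) (Fin d) ℝ) (hA : A.IsHermitian) (lam : Fin d → ℝ),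
    IsSpectrumByMagnitude hA lam →
      9 / 10 ≤ (@Measure.real alg.Seed alg.instMeasurableSpace alg.law
        {s | AccurateTopEigenvalues hk hkd ε (frobNorm A) lam (alg.run A s)})

end

/-!
Query `A` on all pairs from independent uniform sign vectors `x₁, …, x_M`, and let `H` be the
matrix of the answers `x_aᵀ A x_b / M` with its diagonal set to zero. Let `Y` be the matrix with
rows `(A x_a)ᵀ / √M`. It is not known to the algorithm, but it satisfies `YᵀY ≈ A²`, `HY ≈ YA` and
`YYᵀ ≈ H²`, each with expected squared Frobenius error `O(‖A‖_F⁴ / M)`.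

Let `A` have `j + 1` eigenvalues `≥ t > 0`. By counting dimensions, their eigenvectors span some
`u ≠ 0` such that `Y u` is orthogonal to the top `j` eigenvectors of `H`. Evaluating the quadratic
form of `H` at `Y u` shows that the next eigenvalue of `H` is at least `t - 2δ` if the errors are at
most `δ²`. The argument is symmetric in `A` and `H`, so that their positive and their negative
eigenvalues, sorted and continued by zeros, agree up to `2δ`. By Markov's inequality, `M = O(ε⁻⁴)`
suffices for `δ = ε‖A‖_F / 6`, which gives `M² = O(ε⁻⁸)` queries. The algorithm returns the `k`
eigenvalues of `H` of largest magnitude.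
-/

section SortedEigenbases

open scoped InnerProductSpace

variable {E F : Type*} [NormedAddCommGroup E] [InnerProductSpace ℝ E]
  [NormedAddCommGroup F] [InnerProductSpace ℝ F] {n m : ℕ}

/-- The orthonormal basis `b` consists of eigenvectors of the endomorphism `T`, and `l` lists the
corresponding eigenvalues in decreasing order. -/
structure IsSortedEigenbasis (T : E →ₗ[ℝ] E) (b : OrthonormalBasis (Fin n) ℝ E)
    (l : Fin n → ℝ) : Prop where
  apply_eq_smul : ∀ i, T (b i) = l i • b i
  antitone : Antitone l

/-- The `j`-th term of the finite sequence `l`, truncated below at `0` and continued by zeros: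
for sorted eigenvalues, the `j`-th largest positive one, or `0` if there are at most `j` of them. -/
noncomputable def posTerm (l : Fin n → ℝ) (j : ℕ) : ℝ :=
  if h : j < n then max (l ⟨j, h⟩) 0 else 0

theorem posTerm_nonneg (l : Fin n → ℝ) (j : ℕ) : 0 ≤ posTerm l j := by
  unfold posTerm
  split_ifs
  exacts [le_max_right _ _, le_rfl]

theorem posTerm_val (l : Fin n → ℝ) (i : Fin n) : posTerm l i = max (l i) 0 :=
  dif_pos i.isLt

theorem le_posTerm (l : Fin n → ℝ) (i : Fin n) : l i ≤ posTerm l i :=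
  (le_max_left _ _).trans_eq (posTerm_val l i).symm

theorem posTerm_le_iff {l : Fin n → ℝ} {j : ℕ} {r : ℝ} (hr : 0 ≤ r) :
    posTerm l j ≤ r ↔ ∀ hj : j < n, l ⟨j, hj⟩ ≤ r := by
  by_cases hj : j < n <;> simp [posTerm, hj, hr]

theorem posTerm_eq_zero {l : Fin n → ℝ} {j : ℕ} (h : ∀ hj : j < n, l ⟨j, hj⟩ ≤ 0) :
    posTerm l j = 0 :=
  le_antisymm ((posTerm_le_iff le_rfl).2 h) (posTerm_nonneg l j)

namespace IsSortedEigenbasis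

variable {T : E →ₗ[ℝ] E} {b : OrthonormalBasis (Fin n) ℝ E} {l : Fin n → ℝ}

theorem inner_map (h : IsSortedEigenbasis T b l) (i : Fin n) (x : E) :
    ⟪b i, T x⟫_ℝ = l i * ⟪b i, x⟫_ℝ := by
  conv_lhs => rw [← b.sum_repr' x]
  simp [inner_sum, h.apply_eq_smul, inner_smul_right, orthonormal_iff_ite.1 b.orthonormal,
    mul_comm]

theorem neg_rev (h : IsSortedEigenbasis T b l) :
    IsSortedEigenbasis (-T) (b.reindex Fin.revPerm) fun i => -l i.rev where
  apply_eq_smul i := by simp [h.apply_eq_smul]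
  antitone := fun _ _ hij => neg_le_neg (h.antitone (Fin.rev_le_rev.2 hij))

theorem inner_map_self_eq_sum (h : IsSortedEigenbasis T b l) (x : E) :
    ⟪x, T x⟫_ℝ = ∑ i, l i * ⟪b i, x⟫_ℝ ^ 2 := by
  rw [← b.sum_inner_mul_inner]
  refine Finset.sum_congr rfl fun i _ => ?_
  rw [h.inner_map, real_inner_comm]
  ring

theorem inner_map_self_le (h : IsSortedEigenbasis T b l) {j : ℕ} {x : E}
    (hx : ∀ i : Fin n, (i : ℕ) < j → ⟪b i, x⟫_ℝ = 0) :
    ⟪x, T x⟫_ℝ ≤ posTerm l j * ‖x‖ ^ 2 := by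
  rw [h.inner_map_self_eq_sum, ← b.sum_sq_inner_right, Finset.mul_sum]
  refine Finset.sum_le_sum fun i _ => ?_
  rcases lt_or_ge (i : ℕ) j with hi | hi
  · simp [hx i hi]
  · have hj : j < n := hi.trans_lt i.isLt
    have hli : l i ≤ posTerm l j := (h.antitone hi).trans (le_posTerm l ⟨j, hj⟩)
    gcongr

theorem mul_norm_sq_le (h : IsSortedEigenbasis T b l) {j : Fin n} {x : E}
    (hx : ∀ i, j < i → ⟪b i, x⟫_ℝ = 0) : l j * ‖x‖ ^ 2 ≤ ⟪x, T x⟫_ℝ := by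
  rw [h.inner_map_self_eq_sum, ← b.sum_sq_inner_right, Finset.mul_sum]
  refine Finset.sum_le_sum fun i _ => ?_
  rcases lt_or_ge j i with hi | hi
  · simp [hx i hi]
  · have hli : l j ≤ l i := h.antitone hi
    gcongr

theorem mul_norm_le_norm_map (h : IsSortedEigenbasis T b l) {j : Fin n} {x : E}
    (hx : ∀ i, j < i → ⟪b i, x⟫_ℝ = 0) : l j * ‖x‖ ≤ ‖T x‖ := by
  rcases eq_or_ne x 0 with rfl | hx0
  · simp
  refine le_of_mul_le_mul_left ?_ (norm_pos_iff.2 hx0)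
  calc ‖x‖ * (l j * ‖x‖) = l j * ‖x‖ ^ 2 := by ring
    _ ≤ ⟪x, T x⟫_ℝ := h.mul_norm_sq_le hx
    _ ≤ ‖x‖ * ‖T x‖ := real_inner_le_norm _ _

end IsSortedEigenbasis

theorem exists_ne_zero_inner_eq_zero (b : OrthonormalBasis (Fin n) ℝ E)
    (b' : OrthonormalBasis (Fin m) ℝ F) (Y : E →ₗ[ℝ] F) {j : ℕ} (hj : j < n) :
    ∃ u : E, u ≠ 0 ∧ (∀ i : Fin n, j < i → ⟪b i, u⟫_ℝ = 0) ∧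
      ∀ i : Fin m, (i : ℕ) < j → ⟪b' i, Y u⟫_ℝ = 0 := by
  have : FiniteDimensional ℝ E := b.toBasis.finiteDimensional_of_finite
  let s := Finset.Ioi (⟨j, hj⟩ : Fin n)
  let s' := {i : Fin m | (i : ℕ) < j}.toFinset
  let f : E →ₗ[ℝ] (s → ℝ) × (s' → ℝ) :=
    (LinearMap.pi fun i => innerₛₗ ℝ (b i.1)).prod
      (LinearMap.pi fun i => innerₛₗ ℝ (b' i.1) ∘ₗ Y)
  have hs' : s'.card ≤ j := by simp [s', Fin.card_filter_val_lt]
  have hrank : Module.finrank ℝ ((s → ℝ) × (s' → ℝ)) < Module.finrank ℝ E := by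
    rw [Module.finrank_prod, Module.finrank_fintype_fun_eq_card,
      Module.finrank_fintype_fun_eq_card, Module.finrank_eq_card_basis b.toBasis,
      Fintype.card_coe, Fintype.card_coe, Fin.card_Ioi, Fin.val_mk, Fintype.card_fin]
    omega
  obtain ⟨u, hu, hu0⟩ := (Submodule.ne_bot_iff _).1 (f.ker_ne_bot_of_finrank_lt hrank)
  rw [LinearMap.mem_ker] at hu
  exact ⟨u, hu0, fun i hi => congrFun (congrArg Prod.fst hu) ⟨i, Finset.mem_Ioi.2 hi⟩,
    fun i hi => congrFun (congrArg Prod.snd hu) ⟨i, by simpa [s'] using hi⟩⟩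

theorem posTerm_le_add_of_norm_sub_le {S T : E →ₗ[ℝ] E} {b b' : OrthonormalBasis (Fin n) ℝ E}
    {l l' : Fin n → ℝ} (hS : IsSortedEigenbasis S b l) (hT : IsSortedEigenbasis T b' l')
    {η : ℝ} (hη : 0 ≤ η) (h : ∀ x, ‖S x - T x‖ ≤ η * ‖x‖) (j : ℕ) :
    posTerm l j ≤ posTerm l' j + η := by
  have hr := posTerm_nonneg l' j
  refine (posTerm_le_iff (by positivity)).2 fun hj => ?_
  obtain ⟨u, hu0, hu, hu'⟩ := exists_ne_zero_inner_eq_zero b b' LinearMap.id hj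
  refine le_of_mul_le_mul_right ?_ (by positivity : 0 < ‖u‖ ^ 2)
  calc l ⟨j, hj⟩ * ‖u‖ ^ 2 ≤ ⟪u, S u⟫_ℝ := hS.mul_norm_sq_le hu
    _ = ⟪u, T u⟫_ℝ + ⟪u, S u - T u⟫_ℝ := by rw [inner_sub_right]; ring
    _ ≤ posTerm l' j * ‖u‖ ^ 2 + ‖u‖ * (η * ‖u‖) := by
      gcongr
      · exact hT.inner_map_self_le hu'
      · exact (real_inner_le_norm _ _).trans (by gcongr; exact h u)
    _ = (posTerm l' j + η) * ‖u‖ ^ 2 := by ring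

theorem abs_posTerm_sub_le_of_norm_sub_le {S T : E →ₗ[ℝ] E} {b b' : OrthonormalBasis (Fin n) ℝ E}
    {l l' : Fin n → ℝ} (hS : IsSortedEigenbasis S b l) (hT : IsSortedEigenbasis T b' l')
    {η : ℝ} (hη : 0 ≤ η) (h : ∀ x, ‖S x - T x‖ ≤ η * ‖x‖) (j : ℕ) :
    |posTerm l j - posTerm l' j| ≤ η := by
  have hle := posTerm_le_add_of_norm_sub_le hS hT hη h j
  have hge := posTerm_le_add_of_norm_sub_le hT hS hη (fun x => norm_sub_rev (T x) _ ▸ h x) j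
  exact abs_sub_le_iff.2 ⟨by linarith, by linarith⟩

/-- In the application `p = ‖u‖`, `s = ‖A u‖` and `y = ‖Y u‖` for the vector `u` of the min-max
argument, `t` is an eigenvalue of `A`, and `r` is the corresponding eigenvalue of `H`. -/
theorem le_add_two_mul_of_quadratic_bounds {t r δ p s y : ℝ} (hp : 0 < p) (hr : 0 ≤ r)
    (hδ : 0 ≤ δ) (hy : 0 ≤ y) (hs : 0 ≤ s) (hts : t * p ≤ s)
    (hys : |y ^ 2 - s ^ 2| ≤ (δ * p) ^ 2)
    (hquad : t * s ^ 2 ≤ r * y ^ 2 + δ ^ 2 * p * (s + y)) : t ≤ r + 2 * δ := by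
  by_contra! hlt
  obtain ⟨hys₁, hys₂⟩ := abs_le.1 hys
  obtain ⟨q, hq⟩ : ∃ q, q = δ * p := ⟨_, rfl⟩
  have hq0 : 0 ≤ q := hq ▸ by positivity
  have hq_le : 2 * q ≤ s := by nlinarith
  have hs0 : 0 < s := lt_of_lt_of_le (by nlinarith) hts
  rw [← hq] at hys₁ hys₂
  have hy_le : y ≤ 2 * s := by nlinarith
  have hy0 : 0 < y ^ 2 := by nlinarith
  have htq : t * q ^ 2 ≤ δ * q * s := by
    calc t * q ^ 2 = (t * p) * (δ * q) := by rw [hq]; ring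
      _ ≤ s * (δ * q) := by gcongr
      _ = δ * q * s := by ring
  have hlower : t * s ^ 2 - 3 * (δ * q * s) ≤ r * y ^ 2 := by
    have : δ ^ 2 * p * (s + y) ≤ δ * q * (3 * s) := by
      rw [hq, show δ ^ 2 * p = δ * (δ * p) by ring]
      gcongr
      linarith
    linarith
  have hupper : r * y ^ 2 < (t - 2 * δ) * (s ^ 2 + q ^ 2) :=
    (mul_lt_mul_of_pos_right (by linarith) hy0).trans_le
      (mul_le_mul_of_nonneg_left (by linarith) (by linarith))
  have hδq : 2 * (δ * q * s) ≤ δ * s ^ 2 := by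
    calc 2 * (δ * q * s) = δ * (2 * q) * s := by ring
      _ ≤ δ * s * s := by gcongr
      _ = δ * s ^ 2 := by ring
  nlinarith [mul_nonneg hδ (sq_nonneg q)]

theorem posTerm_le_add_of_intertwining {A : E →ₗ[ℝ] E} {H : F →ₗ[ℝ] F}
    {b : OrthonormalBasis (Fin n) ℝ E} {b' : OrthonormalBasis (Fin m) ℝ F}
    {l : Fin n → ℝ} {l' : Fin m → ℝ} (hA : IsSortedEigenbasis A b l)
    (hH : IsSortedEigenbasis H b' l') (Y : E →ₗ[ℝ] F) {δ : ℝ} (hδ : 0 ≤ δ)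
    (hY : ∀ u v, |⟪Y u, Y v⟫_ℝ - ⟪A u, A v⟫_ℝ| ≤ δ ^ 2 * ‖u‖ * ‖v‖)
    (hHY : ∀ u, ‖H (Y u) - Y (A u)‖ ≤ δ ^ 2 * ‖u‖) (j : ℕ) :
    posTerm l j ≤ posTerm l' j + 2 * δ := by
  have hr := posTerm_nonneg l' j
  refine (posTerm_le_iff (by positivity)).2 fun hj => ?_
  obtain ⟨u, hu0, hu, hu'⟩ := exists_ne_zero_inner_eq_zero b b' Y hj
  have hAu : ∀ i : Fin n, j < i → ⟪b i, A u⟫_ℝ = 0 := fun i hi => by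
    rw [hA.inner_map, hu i hi, mul_zero]
  have hYu : |‖Y u‖ ^ 2 - ‖A u‖ ^ 2| ≤ (δ * ‖u‖) ^ 2 := by
    have := hY u u
    rwa [real_inner_self_eq_norm_sq, real_inner_self_eq_norm_sq, mul_assoc, ← sq, ← mul_pow] at this
  refine le_add_two_mul_of_quadratic_bounds (norm_pos_iff.2 hu0) hr hδ (norm_nonneg (Y u))
    (norm_nonneg (A u)) (hA.mul_norm_le_norm_map hu) hYu ?_
  calc l ⟨j, hj⟩ * ‖A u‖ ^ 2 ≤ ⟪A u, A (A u)⟫_ℝ := hA.mul_norm_sq_le hAu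
    _ = ⟪Y u, H (Y u)⟫_ℝ + -(⟪Y u, Y (A u)⟫_ℝ - ⟪A u, A (A u)⟫_ℝ)
        + -⟪Y u, H (Y u) - Y (A u)⟫_ℝ := by rw [inner_sub_right]; ring
    _ ≤ posTerm l' j * ‖Y u‖ ^ 2 + δ ^ 2 * ‖u‖ * ‖A u‖ + ‖Y u‖ * (δ ^ 2 * ‖u‖) := by
      gcongr
      · exact hH.inner_map_self_le hu'
      · exact (neg_le_abs _).trans (hY u (A u))
      · exact (neg_le_abs _).trans
          ((abs_real_inner_le_norm _ _).trans (by gcongr; exact hHY u))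
    _ = posTerm l' j * ‖Y u‖ ^ 2 + δ ^ 2 * ‖u‖ * (‖A u‖ + ‖Y u‖) := by ring

end SortedEigenbases

section SignedEigenvalues

open scoped InnerProductSpace Matrix.Norms.Frobenius

variable {ι κ μ : Type*} [Fintype ι] [Fintype κ] [Fintype μ]

theorem frobenius_norm_sq (B : Matrix κ ι ℝ) : ‖B‖ ^ 2 = ∑ i, ∑ j, B i j ^ 2 := by
  rw [Matrix.frobenius_norm_def, ← Real.sqrt_eq_rpow, Real.sq_sqrt (by positivity)]
  simp

theorem norm_toEuclideanLin_le [DecidableEq ι] (B : Matrix κ ι ℝ) (v : EuclideanSpace ℝ ι) :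
    ‖B.toEuclideanLin v‖ ≤ ‖B‖ * ‖v‖ := by
  refine le_of_sq_le_sq ?_ (by positivity)
  rw [mul_pow, frobenius_norm_sq, Finset.sum_mul, EuclideanSpace.real_norm_sq_eq,
    EuclideanSpace.real_norm_sq_eq]
  exact Finset.sum_le_sum fun i _ => Finset.sum_mul_sq_le_sq_mul_sq _ (B i) v

variable [DecidableEq ι] [DecidableEq κ]

theorem inner_toEuclideanLin_toEuclideanLin (B : Matrix μ ι ℝ) (C : Matrix μ κ ℝ)
    (u : EuclideanSpace ℝ ι) (v : EuclideanSpace ℝ κ) :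
    ⟪B.toEuclideanLin u, C.toEuclideanLin v⟫_ℝ = ⟪u, (Bᵀ * C).toEuclideanLin v⟫_ℝ := by
  classical
  rw [Matrix.toLpLin_mul, ← Matrix.conjTranspose_eq_transpose_of_trivial,
    Matrix.toEuclideanLin_conjTranspose_eq_adjoint, LinearMap.comp_apply,
    LinearMap.adjoint_inner_right]

theorem isSortedEigenbasis_eigenvalues₀ {A : Matrix ι ι ℝ} (hA : A.IsHermitian) :
    IsSortedEigenbasis A.toEuclideanLin
      ((Matrix.isSymmetric_toEuclideanLin_iff.mpr hA).eigenvectorBasis finrank_euclideanSpace)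
      hA.eigenvalues₀ where
  apply_eq_smul i := LinearMap.IsSymmetric.apply_eigenvectorBasis _ _ i
  antitone := hA.eigenvalues₀_antitone

section Intertwining

variable {A : Matrix ι ι ℝ} {H : Matrix κ κ ℝ} {n m : ℕ} {l : Fin n → ℝ} {l' : Fin m → ℝ}
  {b : OrthonormalBasis (Fin n) ℝ (EuclideanSpace ℝ ι)}
  {b' : OrthonormalBasis (Fin m) ℝ (EuclideanSpace ℝ κ)}

theorem posTerm_le_add_of_frobenius_norm_le (hA : IsSortedEigenbasis A.toEuclideanLin b l)
    (hH : IsSortedEigenbasis H.toEuclideanLin b' l') (Y : Matrix κ ι ℝ) {δ : ℝ} (hδ : 0 ≤ δ)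
    (hY : ‖Yᵀ * Y - Aᵀ * A‖ ≤ δ ^ 2) (hHY : ‖H * Y - Y * A‖ ≤ δ ^ 2) (j : ℕ) :
    posTerm l j ≤ posTerm l' j + 2 * δ := by
  refine posTerm_le_add_of_intertwining hA hH Y.toEuclideanLin hδ (fun u v => ?_) (fun u => ?_) j
  · rw [inner_toEuclideanLin_toEuclideanLin, inner_toEuclideanLin_toEuclideanLin,
      ← inner_sub_right, ← LinearMap.sub_apply, ← map_sub]
    calc |⟪u, (Yᵀ * Y - Aᵀ * A).toEuclideanLin v⟫_ℝ|
        ≤ ‖u‖ * ‖(Yᵀ * Y - Aᵀ * A).toEuclideanLin v‖ := abs_real_inner_le_norm _ _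
      _ ≤ ‖u‖ * (δ ^ 2 * ‖v‖) := by
        gcongr
        exact (norm_toEuclideanLin_le _ v).trans (by gcongr)
      _ = δ ^ 2 * ‖u‖ * ‖v‖ := by ring
  · rw [← LinearMap.comp_apply, ← LinearMap.comp_apply, ← Matrix.toLpLin_mul,
      ← Matrix.toLpLin_mul, ← LinearMap.sub_apply, ← map_sub]
    exact (norm_toEuclideanLin_le _ u).trans (by gcongr)

theorem abs_posTerm_sub_le_of_frobenius_norm_le (hA : IsSortedEigenbasis A.toEuclideanLin b l)
    (hH : IsSortedEigenbasis H.toEuclideanLin b' l') (hAs : A.IsSymm) (hHs : H.IsSymm)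
    (Y : Matrix κ ι ℝ) {δ : ℝ} (hδ : 0 ≤ δ) (hY : ‖Yᵀ * Y - A * A‖ ≤ δ ^ 2)
    (hHY : ‖H * Y - Y * A‖ ≤ δ ^ 2) (hY' : ‖Y * Yᵀ - H * H‖ ≤ δ ^ 2) (j : ℕ) :
    |posTerm l j - posTerm l' j| ≤ 2 * δ := by
  have hAY : ‖A * Yᵀ - Yᵀ * H‖ ≤ δ ^ 2 := by
    rw [norm_sub_rev, ← Matrix.frobenius_norm_transpose]
    simpa [Matrix.transpose_mul, hAs.eq, hHs.eq] using hHY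
  have hle := posTerm_le_add_of_frobenius_norm_le hA hH Y hδ (by rwa [hAs.eq]) hHY j
  have hge := posTerm_le_add_of_frobenius_norm_le hH hA Yᵀ hδ
    (by rwa [hHs.eq, Matrix.transpose_transpose]) hAY j
  exact abs_sub_le_iff.2 ⟨by linarith, by linarith⟩

end Intertwining

/-- The first `N` positive eigenvalues and the first `N` negative ones, each sorted by decreasing
magnitude and continued by zeros, where `l` lists the eigenvalues in decreasing order. -/
noncomputable def signedTerms {n : ℕ} (N : ℕ) (l : Fin n → ℝ) : Fin N ⊕ Fin N → ℝ :=
  Sum.elim (fun j => posTerm l j) fun j => -posTerm (fun i => -l i.rev) j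

theorem abs_signedTerms_sub_le {n m N : ℕ} {l : Fin n → ℝ} {l' : Fin m → ℝ} {η : ℝ}
    (hpos : ∀ j, |posTerm l j - posTerm l' j| ≤ η)
    (hneg : ∀ j, |posTerm (fun i => -l i.rev) j - posTerm (fun i => -l' i.rev) j| ≤ η)
    (x : Fin N ⊕ Fin N) : |signedTerms N l x - signedTerms N l' x| ≤ η := by
  rcases x with j | j
  · exact hpos j
  · simpa only [signedTerms, Sum.elim_inr, neg_sub_neg, abs_sub_comm] using hneg j

theorem abs_signedTerms_eigenvalues₀_sub_le {A : Matrix ι ι ℝ} {H : Matrix κ κ ℝ}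
    (hA : A.IsHermitian) (hH : H.IsHermitian) (Y : Matrix κ ι ℝ) {δ : ℝ} (hδ : 0 ≤ δ)
    (hY : ‖Yᵀ * Y - A * A‖ ≤ δ ^ 2) (hHY : ‖H * Y - Y * A‖ ≤ δ ^ 2)
    (hY' : ‖Y * Yᵀ - H * H‖ ≤ δ ^ 2) {N : ℕ} (x : Fin N ⊕ Fin N) :
    |signedTerms N hA.eigenvalues₀ x - signedTerms N hH.eigenvalues₀ x| ≤ 2 * δ := by
  have hAb := isSortedEigenbasis_eigenvalues₀ hA
  have hHb := isSortedEigenbasis_eigenvalues₀ hH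
  have hAs := Matrix.isHermitian_iff_isSymm.1 hA
  have hHs := Matrix.isHermitian_iff_isSymm.1 hH
  refine abs_signedTerms_sub_le
    (abs_posTerm_sub_le_of_frobenius_norm_le hAb hHb hAs hHs Y hδ hY hHY hY')
    (abs_posTerm_sub_le_of_frobenius_norm_le (A := -A) (H := -H) (by simpa using hAb.neg_rev)
      (by simpa using hHb.neg_rev) hAs.neg hHs.neg Y hδ (by simpa using hY) ?_
      (by simpa using hY')) x
  rwa [Matrix.neg_mul, Matrix.mul_neg, neg_sub_neg, norm_sub_rev]

theorem abs_signedTerms_eigenvalues₀_sub_le_norm {A A' : Matrix ι ι ℝ} (hA : A.IsHermitian)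
    (hA' : A'.IsHermitian) {N : ℕ} (x : Fin N ⊕ Fin N) :
    |signedTerms N hA.eigenvalues₀ x - signedTerms N hA'.eigenvalues₀ x| ≤ ‖A - A'‖ := by
  have hb := isSortedEigenbasis_eigenvalues₀ hA
  have hb' := isSortedEigenbasis_eigenvalues₀ hA'
  refine abs_signedTerms_sub_le
    (abs_posTerm_sub_le_of_norm_sub_le hb hb' (norm_nonneg _) fun v => ?_)
    (abs_posTerm_sub_le_of_norm_sub_le hb.neg_rev hb'.neg_rev (norm_nonneg _) fun v => ?_) x
  · rw [← LinearMap.sub_apply, ← map_sub]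
    exact norm_toEuclideanLin_le _ v
  · rw [← LinearMap.sub_apply, neg_sub_neg, ← map_sub, norm_sub_rev A]
    exact norm_toEuclideanLin_le _ v

end SignedEigenvalues

section Moments

open scoped BigOperators Matrix.Norms.Frobenius

variable {R ι κ μ : Type*}

section Resampling

variable [Fintype R] [Fintype κ] [DecidableEq κ]

theorem expect_resample (c : κ) (f : (κ → R) → ℝ) :
    𝔼 ω, f ω = 𝔼 ω, 𝔼 r, f (Function.update ω c r) := by
  rcases isEmpty_or_nonempty R with hR | hR
  · have : IsEmpty (κ → R) := ⟨fun ω => hR.false (ω c)⟩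
    simp
  let swap : (κ → R) × R ≃ (κ → R) × R :=
    { toFun := fun p => (Function.update p.1 c p.2, p.1 c)
      invFun := fun p => (Function.update p.1 c p.2, p.1 c)
      left_inv := fun p => by simp
      right_inv := fun p => by simp }
  calc 𝔼 ω, f ω = 𝔼 p : (κ → R) × R, f p.1 := by
        simp [← Finset.univ_product_univ, Finset.expect_product]
    _ = 𝔼 p : (κ → R) × R, f (Function.update p.1 c p.2) :=
        (Fintype.expect_equiv swap _ _ fun _ => rfl).symm
    _ = 𝔼 ω, 𝔼 r, f (Function.update ω c r) := by
        rw [← Finset.univ_product_univ, Finset.expect_product]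

variable [Nonempty R]

theorem expect_sq_sum_add_of_expect_eq_zero {f : R → ℝ} (hf : 𝔼 r, f r = 0) (S : Finset κ)
    (β : ℝ) : 𝔼 ω : κ → R, (∑ c ∈ S, f (ω c) + β) ^ 2 = S.card * 𝔼 r, f r ^ 2 + β ^ 2 := by
  induction S using Finset.induction_on with
  | empty => simp
  | insert c S hc ih =>
    have hexpand : ∀ (ω : κ → R) r, (∑ c' ∈ insert c S, f (Function.update ω c r c') + β) ^ 2 =
        f r ^ 2 + f r * (2 * (∑ c' ∈ S, f (ω c') + β)) + (∑ c' ∈ S, f (ω c') + β) ^ 2 := by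
      intro ω r
      have hrest : ∑ c' ∈ S, f (Function.update ω c r c') = ∑ c' ∈ S, f (ω c') :=
        Finset.sum_congr rfl fun c' hc' => by
          rw [Function.update_of_ne (ne_of_mem_of_not_mem hc' hc)]
      rw [Finset.sum_insert hc, Function.update_self, hrest]
      ring
    rw [expect_resample c]
    simp_rw [hexpand, Finset.expect_add_distrib, ← Finset.expect_mul, hf, zero_mul,
      Fintype.expect_const, add_zero]
    rw [ih, Finset.card_insert_of_notMem hc]
    push_cast
    ring

theorem expect_sq_sum_sub_le (f : R → ℝ) (S : Finset κ) (N : ℝ) :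
    𝔼 ω : κ → R, (∑ c ∈ S, f (ω c) - N * 𝔼 r, f r) ^ 2 ≤
      S.card * 𝔼 r, f r ^ 2 + (N - S.card) ^ 2 * (𝔼 r, f r) ^ 2 := by
  obtain ⟨e, he⟩ : ∃ e, e = 𝔼 r, f r := ⟨_, rfl⟩
  have hcentered : 𝔼 r, (f r - e) = 0 := by
    rw [Finset.expect_sub_distrib, Fintype.expect_const, ← he, sub_self]
  have hvar : 𝔼 r, (f r - e) ^ 2 ≤ 𝔼 r, f r ^ 2 := by
    have hsq : ∀ r, f r ^ 2 = (f r - e) ^ 2 + (f r - e) * (2 * e) + e ^ 2 := fun r => by ring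
    simp_rw [hsq, Finset.expect_add_distrib, ← Finset.expect_mul, hcentered,
      Fintype.expect_const]
    linarith [sq_nonneg e]
  have hshift : ∀ ω : κ → R, ∑ c ∈ S, f (ω c) - N * e =
      ∑ c ∈ S, (f (ω c) - e) + (S.card - N) * e := fun ω => by
    rw [Finset.sum_sub_distrib, Finset.sum_const, nsmul_eq_mul]
    ring
  simp_rw [← he, hshift]
  rw [expect_sq_sum_add_of_expect_eq_zero hcentered S, mul_pow, sub_sq_comm]
  gcongr

theorem expect_sq_sum_sub_card_mul_le {f : R → ℝ} {m : ℝ} (hsq : 𝔼 r, f r ^ 2 ≤ 3 * m)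
    (hmean : (𝔼 r, f r) ^ 2 ≤ m) {S : Finset κ} (hS : Fintype.card κ ≤ S.card + 3) :
    𝔼 ω : κ → R, (∑ c ∈ S, f (ω c) - Fintype.card κ * 𝔼 r, f r) ^ 2 ≤
      3 * Fintype.card κ * m := by
  have hle : (S.card : ℝ) ≤ Fintype.card κ := mod_cast S.card_le_univ
  have hge : (Fintype.card κ : ℝ) ≤ S.card + 3 := mod_cast hS
  have hgap : ((Fintype.card κ : ℝ) - S.card) ^ 2 ≤ 3 * (Fintype.card κ - S.card) := by nlinarith
  calc 𝔼 ω : κ → R, (∑ c ∈ S, f (ω c) - Fintype.card κ * 𝔼 r, f r) ^ 2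
      ≤ S.card * 𝔼 r, f r ^ 2 + ((Fintype.card κ : ℝ) - S.card) ^ 2 * (𝔼 r, f r) ^ 2 :=
        expect_sq_sum_sub_le f S _
    _ ≤ S.card * (3 * m) + 3 * (Fintype.card κ - S.card) * m :=
        add_le_add (mul_le_mul_of_nonneg_left hsq (Nat.cast_nonneg _))
          (mul_le_mul hgap hmean (sq_nonneg _) (by linarith))
    _ = 3 * Fintype.card κ * m := by ring

end Resampling

variable [Fintype ι]

/-- A finite family of vectors whose uniform average has the second moments of an isotropic
distribution and fourth moments bounded as for a Gaussian one. -/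
structure IsotropicFamily [Fintype R] (g : R → ι → ℝ) : Prop where
  expect_dotProduct_sq : ∀ u, 𝔼 r, (u ⬝ᵥ g r) ^ 2 = u ⬝ᵥ u
  expect_dotProduct_pow_four_le : ∀ u, 𝔼 r, (u ⬝ᵥ g r) ^ 4 ≤ 3 * (u ⬝ᵥ u) ^ 2

theorem frobenius_norm_sq_eq_sum_dotProduct [Fintype μ] (B : Matrix μ ι ℝ) :
    ‖B‖ ^ 2 = ∑ i, B i ⬝ᵥ B i := by
  rw [frobenius_norm_sq]
  simp only [dotProduct, sq]

namespace IsotropicFamily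

variable [Fintype R] [Fintype μ] {g : R → ι → ℝ}

theorem expect_dotProduct_mul_dotProduct (hg : IsotropicFamily g) (u v : ι → ℝ) :
    𝔼 r, (u ⬝ᵥ g r) * (v ⬝ᵥ g r) = u ⬝ᵥ v := by
  have hpolar : ∀ r, (u ⬝ᵥ g r) * (v ⬝ᵥ g r) =
      ((u + v) ⬝ᵥ g r) ^ 2 / 4 - ((u - v) ⬝ᵥ g r) ^ 2 / 4 := fun r => by
    rw [add_dotProduct, sub_dotProduct]
    ring
  simp_rw [hpolar, Finset.expect_sub_distrib, ← Finset.expect_div, hg.expect_dotProduct_sq]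
  simp only [add_dotProduct, dotProduct_add, sub_dotProduct, dotProduct_sub, dotProduct_comm v u]
  ring

theorem expect_vecMul_dotProduct_self (hg : IsotropicFamily g) (Q : Matrix ι μ ℝ) :
    𝔼 r, (g r ᵥ* Q) ⬝ᵥ (g r ᵥ* Q) = ‖Q‖ ^ 2 := by
  rw [← Matrix.frobenius_norm_transpose, frobenius_norm_sq_eq_sum_dotProduct]
  simp_rw [← hg.expect_dotProduct_sq, ← Finset.expect_sum_comm]
  refine Finset.expect_congr rfl fun r _ => Finset.sum_congr rfl fun j _ => ?_
  rw [← sq, ← Matrix.mulVec_transpose]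
  rfl

theorem expect_dotProduct_sq_mul_le (hg : IsotropicFamily g) (u v : ι → ℝ) :
    𝔼 r, (u ⬝ᵥ g r) ^ 2 * (v ⬝ᵥ g r) ^ 2 ≤ 3 * ((u ⬝ᵥ u) * (v ⬝ᵥ v)) := by
  have hu : 0 ≤ u ⬝ᵥ u := Finset.sum_nonneg fun _ _ => mul_self_nonneg _
  have hv : 0 ≤ v ⬝ᵥ v := Finset.sum_nonneg fun _ _ => mul_self_nonneg _
  refine le_of_sq_le_sq ?_ (by positivity)
  calc (𝔼 r, (u ⬝ᵥ g r) ^ 2 * (v ⬝ᵥ g r) ^ 2) ^ 2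
      ≤ (𝔼 r, ((u ⬝ᵥ g r) ^ 2) ^ 2) * 𝔼 r, ((v ⬝ᵥ g r) ^ 2) ^ 2 :=
        Finset.expect_mul_sq_le_sq_mul_sq _ _ _
    _ = (𝔼 r, (u ⬝ᵥ g r) ^ 4) * 𝔼 r, (v ⬝ᵥ g r) ^ 4 := by simp_rw [← pow_mul]
    _ ≤ (3 * (u ⬝ᵥ u) ^ 2) * (3 * (v ⬝ᵥ v) ^ 2) :=
        mul_le_mul (hg.expect_dotProduct_pow_four_le u) (hg.expect_dotProduct_pow_four_le v)
          (Finset.expect_nonneg fun _ _ => by positivity) (by positivity)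
    _ = (3 * ((u ⬝ᵥ u) * (v ⬝ᵥ v))) ^ 2 := by ring

theorem expect_mulVec_dotProduct_self_sq_le (hg : IsotropicFamily g) (A : Matrix μ ι ℝ) :
    𝔼 r, ((A *ᵥ g r) ⬝ᵥ (A *ᵥ g r)) ^ 2 ≤ 3 * ‖A‖ ^ 4 := by
  have hexpand : ∀ r, ((A *ᵥ g r) ⬝ᵥ (A *ᵥ g r)) ^ 2 =
      ∑ i, ∑ j, (A i ⬝ᵥ g r) ^ 2 * (A j ⬝ᵥ g r) ^ 2 := fun r => by
    rw [← Finset.sum_mul_sum, sq]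
    simp only [dotProduct, Matrix.mulVec, sq]
  calc 𝔼 r, ((A *ᵥ g r) ⬝ᵥ (A *ᵥ g r)) ^ 2
      = ∑ i, ∑ j, 𝔼 r, (A i ⬝ᵥ g r) ^ 2 * (A j ⬝ᵥ g r) ^ 2 := by
        simp_rw [hexpand, Finset.expect_sum_comm]
    _ ≤ ∑ i, ∑ j, 3 * ((A i ⬝ᵥ A i) * (A j ⬝ᵥ A j)) := by
        gcongr
        exact hg.expect_dotProduct_sq_mul_le _ _
    _ = 3 * (‖A‖ ^ 2) ^ 2 := by
        simp_rw [← Finset.mul_sum, ← Finset.sum_mul, frobenius_norm_sq_eq_sum_dotProduct, sq]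
    _ = 3 * ‖A‖ ^ 4 := by ring

end IsotropicFamily

/-- The error of `A Aᵀ` as an approximation of the average of the rank-one matrices
`A x_c (A x_c)ᵀ`, scaled by the number of indices. The sum runs over a subset `S` only, which makes
the error independent of the vectors outside of `S`. -/
def gramError [Fintype κ] (A : Matrix μ ι ℝ) (x : κ → ι → ℝ) (S : Finset κ) : Matrix μ μ ℝ :=
  ∑ c ∈ S, Matrix.vecMulVec (A *ᵥ x c) (A *ᵥ x c) - (Fintype.card κ : ℝ) • (A * Aᵀ)

theorem gramError_apply [Fintype κ] (A : Matrix μ ι ℝ) (x : κ → ι → ℝ) (S : Finset κ)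
    (i j : μ) : gramError A x S i j =
      ∑ c ∈ S, (A *ᵥ x c) i * (A *ᵥ x c) j - Fintype.card κ * (A * Aᵀ) i j := by
  rw [gramError, Matrix.sub_apply, Matrix.sum_apply, Matrix.smul_apply, smul_eq_mul]
  rfl

theorem vecMul_gramError [Fintype κ] [Fintype μ] (A : Matrix μ ι ℝ) (x : κ → ι → ℝ)
    (S : Finset κ) (y : μ → ℝ) : y ᵥ* gramError A x S =
      ∑ c ∈ S, (y ⬝ᵥ A *ᵥ x c) • (A *ᵥ x c) - (Fintype.card κ : ℝ) • (y ᵥ* (A * Aᵀ)) := by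
  simp_rw [gramError, Matrix.vecMul_sub, Matrix.vecMul_sum, Matrix.vecMul_vecMulVec,
    Matrix.vecMul_smul]

theorem gramError_update [Fintype κ] [DecidableEq κ] (A : Matrix μ ι ℝ) (g : R → ι → ℝ)
    (ω : κ → R) {S : Finset κ} {a : κ} (ha : a ∉ S) (r : R) :
    gramError A (fun c => g (Function.update ω a r c)) S = gramError A (fun c => g (ω c)) S := by
  unfold gramError
  congr 1
  exact Finset.sum_congr rfl fun c hc => by
    simp only [Function.update_of_ne (ne_of_mem_of_not_mem hc ha)]

namespace IsotropicFamily

variable [Fintype R] [Nonempty R] [Fintype κ] [DecidableEq κ] [Fintype μ]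
  {g : R → ι → ℝ} {S : Finset κ}

theorem expect_norm_gramError_sq_le (hg : IsotropicFamily g) (A : Matrix μ ι ℝ)
    (hS : Fintype.card κ ≤ S.card + 3) :
    𝔼 ω : κ → R, ‖gramError A (fun c => g (ω c)) S‖ ^ 2 ≤ 3 * Fintype.card κ * ‖A‖ ^ 4 := by
  have hmean : ∀ i j, 𝔼 r, (A *ᵥ g r) i * (A *ᵥ g r) j = (A * Aᵀ) i j := fun i j =>
    hg.expect_dotProduct_mul_dotProduct (A i) (A j)
  have hentry : ∀ i j, 𝔼 ω : κ → R, gramError A (fun c => g (ω c)) S i j ^ 2 ≤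
      3 * Fintype.card κ * ((A i ⬝ᵥ A i) * (A j ⬝ᵥ A j)) := fun i j => by
    simp_rw [gramError_apply, ← hmean]
    refine expect_sq_sum_sub_card_mul_le (f := fun r => (A *ᵥ g r) i * (A *ᵥ g r) j) ?_ ?_ hS
    · simp_rw [mul_pow]
      exact hg.expect_dotProduct_sq_mul_le (A i) (A j)
    · have hcs := Finset.sum_mul_sq_le_sq_mul_sq Finset.univ (A i) (A j)
      rw [hmean]
      simpa only [dotProduct, Matrix.mul_apply, Matrix.transpose_apply, sq] using hcs
  calc 𝔼 ω : κ → R, ‖gramError A (fun c => g (ω c)) S‖ ^ 2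
      = ∑ i, ∑ j, 𝔼 ω : κ → R, gramError A (fun c => g (ω c)) S i j ^ 2 := by
        simp_rw [frobenius_norm_sq, Finset.expect_sum_comm]
    _ ≤ ∑ i, ∑ j, 3 * Fintype.card κ * ((A i ⬝ᵥ A i) * (A j ⬝ᵥ A j)) :=
        Finset.sum_le_sum fun i _ => Finset.sum_le_sum fun j _ => hentry i j
    _ = 3 * Fintype.card κ * (‖A‖ ^ 2) ^ 2 := by
        simp_rw [← Finset.mul_sum, ← Finset.sum_mul, frobenius_norm_sq_eq_sum_dotProduct, sq]
    _ = 3 * Fintype.card κ * ‖A‖ ^ 4 := by ring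

theorem expect_vecMul_gramError_le (hg : IsotropicFamily g) (A : Matrix ι ι ℝ)
    (hS : Fintype.card κ ≤ S.card + 3) {a : κ} (ha : a ∉ S) :
    𝔼 ω : κ → R, (g (ω a) ᵥ* gramError A (fun c => g (ω c)) S) ⬝ᵥ
      (g (ω a) ᵥ* gramError A (fun c => g (ω c)) S) ≤ 3 * Fintype.card κ * ‖A‖ ^ 4 := by
  rw [expect_resample a]
  simp_rw [gramError_update A g _ ha, Function.update_self,
    hg.expect_vecMul_dotProduct_self]
  exact hg.expect_norm_gramError_sq_le A hS

theorem expect_quadForm_gramError_sq_le (hg : IsotropicFamily g) (A : Matrix μ ι ℝ)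
    (hS : Fintype.card κ ≤ S.card + 3) (y : μ → ℝ) :
    𝔼 ω : κ → R, ((y ᵥ* gramError A (fun c => g (ω c)) S) ⬝ᵥ y) ^ 2 ≤
      3 * Fintype.card κ * ((Aᵀ *ᵥ y) ⬝ᵥ (Aᵀ *ᵥ y)) ^ 2 := by
  obtain ⟨u, hu⟩ : ∃ u, u = Aᵀ *ᵥ y := ⟨_, rfl⟩
  have hyA : ∀ v, y ⬝ᵥ A *ᵥ v = u ⬝ᵥ v := fun v => by
    rw [Matrix.dotProduct_mulVec, hu, Matrix.mulVec_transpose]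
  have hform : ∀ ω : κ → R, (y ᵥ* gramError A (fun c => g (ω c)) S) ⬝ᵥ y =
      ∑ c ∈ S, (u ⬝ᵥ g (ω c)) ^ 2 - Fintype.card κ * 𝔼 r, (u ⬝ᵥ g r) ^ 2 := fun ω => by
    rw [vecMul_gramError, sub_dotProduct, sum_dotProduct, smul_dotProduct, smul_eq_mul,
      hg.expect_dotProduct_sq, ← Matrix.dotProduct_mulVec, ← Matrix.mulVec_mulVec, ← hu, hyA]
    simp only [smul_dotProduct, smul_eq_mul, dotProduct_comm (A *ᵥ _) y, hyA, sq]
  have hmean := hg.expect_dotProduct_sq u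
  simp_rw [hform, ← hu]
  refine expect_sq_sum_sub_card_mul_le (f := fun r => (u ⬝ᵥ g r) ^ 2) ?_ (by rw [hmean]) hS
  simp_rw [← pow_mul]
  exact hg.expect_dotProduct_pow_four_le u

theorem expect_bilin_gramError_sq_le (hg : IsotropicFamily g) (A : Matrix ι ι ℝ)
    (hS : Fintype.card κ ≤ S.card + 3) {a b : κ} (ha : a ∉ S) (hb : b ∉ S) :
    𝔼 ω : κ → R, ((g (ω a) ᵥ* gramError A (fun c => g (ω c)) S) ⬝ᵥ g (ω b)) ^ 2 ≤
      9 * Fintype.card κ * ‖A‖ ^ 4 := by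
  rw [expect_resample b]
  rcases eq_or_ne a b with rfl | hab
  · simp_rw [gramError_update A g _ hb, Function.update_self]
    rw [Finset.expect_comm]
    calc 𝔼 r, 𝔼 ω : κ → R, ((g r ᵥ* gramError A (fun c => g (ω c)) S) ⬝ᵥ g r) ^ 2
        ≤ 𝔼 r, 3 * Fintype.card κ * ((Aᵀ *ᵥ g r) ⬝ᵥ (Aᵀ *ᵥ g r)) ^ 2 :=
          Finset.expect_le_expect fun r _ => hg.expect_quadForm_gramError_sq_le A hS (g r)
      _ ≤ 3 * Fintype.card κ * (3 * ‖Aᵀ‖ ^ 4) := by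
          rw [← Finset.mul_expect]
          exact mul_le_mul_of_nonneg_left (hg.expect_mulVec_dotProduct_self_sq_le Aᵀ)
            (by positivity)
      _ = 9 * Fintype.card κ * ‖A‖ ^ 4 := by rw [Matrix.frobenius_norm_transpose]; ring
  · simp_rw [gramError_update A g _ hb, Function.update_self, Function.update_of_ne hab,
      hg.expect_dotProduct_sq]
    have hnonneg : 0 ≤ Fintype.card κ * ‖A‖ ^ 4 := by positivity
    linarith [hg.expect_vecMul_gramError_le A hS ha]

end IsotropicFamily

end Moments

section Sketch

open scoped BigOperators Matrix.Norms.Frobenius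

variable {R ι κ μ : Type*} [Fintype ι] [Fintype κ]

/-- The scaled bilinear form of `A` on all pairs of distinct vectors of the family `x`. The diagonal
is left out since the variance of its entries is too large. -/
noncomputable def offDiagSketch [DecidableEq κ] (A : Matrix ι ι ℝ) (x : κ → ι → ℝ) :
    Matrix κ κ ℝ :=
  Matrix.of fun a b => if a = b then 0 else (x a ⬝ᵥ A *ᵥ x b) / Fintype.card κ

/-- The matrix with rows `A x_a / √m`, where `m` is the number of vectors in the family `x`. -/
noncomputable def rowSketch (A : Matrix μ ι ℝ) (x : κ → ι → ℝ) : Matrix κ μ ℝ :=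
  Matrix.of fun a => (√(Fintype.card κ))⁻¹ • (A *ᵥ x a)

theorem rowSketch_apply (A : Matrix μ ι ℝ) (x : κ → ι → ℝ) (a : κ) :
    rowSketch A x a = (√(Fintype.card κ))⁻¹ • (A *ᵥ x a) := rfl

theorem rowSketch_transpose_mul_self_sub [Nonempty κ] (A : Matrix μ ι ℝ) (x : κ → ι → ℝ) :
    (rowSketch A x)ᵀ * rowSketch A x - A * Aᵀ =
      (Fintype.card κ : ℝ)⁻¹ • gramError A x Finset.univ := by
  have hcard : (Fintype.card κ : ℝ) ≠ 0 := Nat.cast_ne_zero.2 Fintype.card_ne_zero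
  ext i j
  have hmul : ((rowSketch A x)ᵀ * rowSketch A x) i j =
      (Fintype.card κ : ℝ)⁻¹ * ∑ c, (A *ᵥ x c) i * (A *ᵥ x c) j := by
    rw [Matrix.mul_apply, Finset.mul_sum]
    refine Finset.sum_congr rfl fun c _ => ?_
    rw [Matrix.transpose_apply, rowSketch_apply, Pi.smul_apply, Pi.smul_apply, smul_eq_mul,
      smul_eq_mul, mul_mul_mul_comm, ← mul_inv, Real.mul_self_sqrt (Nat.cast_nonneg _)]
  rw [Matrix.sub_apply, hmul, Matrix.smul_apply, gramError_apply, smul_eq_mul, mul_sub,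
    inv_mul_cancel_left₀ hcard]

variable [DecidableEq κ]

theorem offDiagSketch_self (A : Matrix ι ι ℝ) (x : κ → ι → ℝ) (a : κ) :
    offDiagSketch A x a a = 0 := if_pos rfl

theorem offDiagSketch_of_ne (A : Matrix ι ι ℝ) (x : κ → ι → ℝ) {a b : κ} (hab : a ≠ b) :
    offDiagSketch A x a b = (x a ⬝ᵥ A *ᵥ x b) / Fintype.card κ := if_neg hab

theorem offDiagSketch_mul_rowSketch_sub_apply [Nonempty κ] {A : Matrix ι ι ℝ} (hA : A.IsSymm)
    (x : κ → ι → ℝ) (a : κ) :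
    (offDiagSketch A x * rowSketch A x - rowSketch A x * A) a =
      (Fintype.card κ * √(Fintype.card κ) : ℝ)⁻¹ • (x a ᵥ* gramError A x {a}ᶜ) := by
  have hcard : (Fintype.card κ : ℝ) ≠ 0 := Nat.cast_ne_zero.2 Fintype.card_ne_zero
  have hleft : (offDiagSketch A x * rowSketch A x) a =
      (Fintype.card κ * √(Fintype.card κ) : ℝ)⁻¹ •
        ∑ c ∈ {a}ᶜ, (x a ⬝ᵥ A *ᵥ x c) • (A *ᵥ x c) := by
    rw [Matrix.mul_apply_eq_vecMul, Matrix.vecMul_eq_sum, Finset.smul_sum,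
      ← Finset.sum_add_sum_compl {a}, Finset.sum_singleton, offDiagSketch_self, zero_smul, zero_add]
    refine Finset.sum_congr rfl fun c hc => ?_
    rw [offDiagSketch_of_ne A x (by simpa [eq_comm] using hc), rowSketch_apply, smul_smul,
      smul_smul]
    ring_nf
  have hright : (rowSketch A x * A) a =
      (Fintype.card κ * √(Fintype.card κ) : ℝ)⁻¹ •
        ((Fintype.card κ : ℝ) • (x a ᵥ* (A * Aᵀ))) := by
    rw [Matrix.mul_apply_eq_vecMul, rowSketch_apply, Matrix.smul_vecMul, smul_smul, mul_inv,
      mul_right_comm, inv_mul_cancel₀ hcard, one_mul, ← Matrix.vecMul_vecMul, hA.eq,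
      ← Matrix.vecMul_transpose, hA.eq]
  rw [vecMul_gramError, smul_sub, ← hleft, ← hright]
  rfl

theorem rowSketch_mul_transpose_sub_apply {A : Matrix ι ι ℝ} (hA : A.IsSymm) (x : κ → ι → ℝ)
    (a b : κ) :
    (rowSketch A x * (rowSketch A x)ᵀ - offDiagSketch A x * offDiagSketch A x) a b =
      -((Fintype.card κ : ℝ) ^ 2)⁻¹ * ((x a ᵥ* gramError A x {a, b}ᶜ) ⬝ᵥ x b) := by
  have hcard : (Fintype.card κ : ℝ) ≠ 0 := Nat.cast_ne_zero.2 (Fintype.card_pos_iff.2 ⟨a⟩).ne'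
  have hrow : (rowSketch A x * (rowSketch A x)ᵀ) a b =
      ((Fintype.card κ : ℝ) ^ 2)⁻¹ * (Fintype.card κ * ((x a ᵥ* (A * Aᵀ)) ⬝ᵥ x b)) := by
    have hgram : (x a ᵥ* (A * Aᵀ)) ⬝ᵥ x b = (A *ᵥ x a) ⬝ᵥ (A *ᵥ x b) := by
      rw [← Matrix.vecMul_vecMul, ← Matrix.dotProduct_mulVec, ← Matrix.mulVec_transpose, hA.eq]
    calc (rowSketch A x * (rowSketch A x)ᵀ) a b = rowSketch A x a ⬝ᵥ rowSketch A x b := rfl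
      _ = (√(Fintype.card κ) * √(Fintype.card κ))⁻¹ * ((A *ᵥ x a) ⬝ᵥ (A *ᵥ x b)) := by
        rw [rowSketch_apply, rowSketch_apply, smul_dotProduct, dotProduct_smul, smul_smul,
          ← mul_inv, smul_eq_mul]
      _ = _ := by
        rw [Real.mul_self_sqrt (Nat.cast_nonneg _), hgram]
        field_simp
  have hoff : (offDiagSketch A x * offDiagSketch A x) a b =
      ((Fintype.card κ : ℝ) ^ 2)⁻¹ *
        ∑ c ∈ {a, b}ᶜ, (x a ⬝ᵥ A *ᵥ x c) * ((A *ᵥ x c) ⬝ᵥ x b) := by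
    have hzero : ∀ c ∈ ({a, b} : Finset κ), offDiagSketch A x a c * offDiagSketch A x c b = 0 := by
      simp [offDiagSketch_self]
    rw [Matrix.mul_apply, ← Finset.sum_add_sum_compl {a, b}, Finset.sum_eq_zero hzero, zero_add,
      Finset.mul_sum]
    refine Finset.sum_congr rfl fun c hc => ?_
    simp only [Finset.mem_compl, Finset.mem_insert, Finset.mem_singleton, not_or] at hc
    rw [offDiagSketch_of_ne A x (Ne.symm hc.1), offDiagSketch_of_ne A x hc.2,
      Matrix.dotProduct_mulVec (x c), ← Matrix.mulVec_transpose, hA.eq]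
    ring
  rw [Matrix.sub_apply, hrow, hoff, vecMul_gramError, sub_dotProduct, sum_dotProduct]
  simp only [smul_dotProduct, smul_eq_mul]
  ring

/-- The total squared error of the approximate identities `YᵀY ≈ A²`, `HY ≈ YA` and `YYᵀ ≈ H²`
between a symmetric matrix `A` and its sketches `H` (off-diagonal) and `Y` (rows). -/
noncomputable def sketchError (A : Matrix ι ι ℝ) (x : κ → ι → ℝ) : ℝ :=
  ‖(rowSketch A x)ᵀ * rowSketch A x - A * A‖ ^ 2 +
  ‖offDiagSketch A x * rowSketch A x - rowSketch A x * A‖ ^ 2 +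
  ‖rowSketch A x * (rowSketch A x)ᵀ - offDiagSketch A x * offDiagSketch A x‖ ^ 2

theorem sketchError_nonneg (A : Matrix ι ι ℝ) (x : κ → ι → ℝ) : 0 ≤ sketchError A x := by
  unfold sketchError
  positivity

theorem norm_sq_transpose_mul_self_sub_le_sketchError (A : Matrix ι ι ℝ) (x : κ → ι → ℝ) :
    ‖(rowSketch A x)ᵀ * rowSketch A x - A * A‖ ^ 2 ≤ sketchError A x := by
  rw [sketchError, add_assoc]
  exact le_add_of_nonneg_right (by positivity)

theorem norm_sq_mul_sub_mul_le_sketchError (A : Matrix ι ι ℝ) (x : κ → ι → ℝ) :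
    ‖offDiagSketch A x * rowSketch A x - rowSketch A x * A‖ ^ 2 ≤ sketchError A x := by
  rw [sketchError, add_right_comm]
  exact le_add_of_nonneg_left (by positivity)

theorem norm_sq_mul_transpose_sub_le_sketchError (A : Matrix ι ι ℝ) (x : κ → ι → ℝ) :
    ‖rowSketch A x * (rowSketch A x)ᵀ - offDiagSketch A x * offDiagSketch A x‖ ^ 2 ≤
      sketchError A x :=
  le_add_of_nonneg_left (by positivity)

namespace IsotropicFamily

variable [Fintype R] [Nonempty R] [Nonempty κ] {g : R → ι → ℝ}

theorem expect_norm_sq_transpose_mul_self_sub_le [Fintype μ] (hg : IsotropicFamily g)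
    (A : Matrix μ ι ℝ) :
    𝔼 ω : κ → R, ‖(rowSketch A fun c => g (ω c))ᵀ * (rowSketch A fun c => g (ω c)) -
      A * Aᵀ‖ ^ 2 ≤ 3 * ‖A‖ ^ 4 / Fintype.card κ := by
  simp_rw [rowSketch_transpose_mul_self_sub, norm_smul, mul_pow, ← Finset.mul_expect, norm_inv,
    Real.norm_natCast]
  calc ((Fintype.card κ : ℝ)⁻¹) ^ 2 * 𝔼 ω : κ → R, ‖gramError A (fun c => g (ω c)) .univ‖ ^ 2
      ≤ ((Fintype.card κ : ℝ)⁻¹) ^ 2 * (3 * Fintype.card κ * ‖A‖ ^ 4) :=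
        mul_le_mul_of_nonneg_left
          (hg.expect_norm_gramError_sq_le A (by rw [Finset.card_univ]; omega)) (by positivity)
    _ = 3 * ‖A‖ ^ 4 / Fintype.card κ := by field_simp

theorem expect_norm_sq_mul_sub_mul_le (hg : IsotropicFamily g) {A : Matrix ι ι ℝ}
    (hA : A.IsSymm) :
    𝔼 ω : κ → R, ‖offDiagSketch A (fun c => g (ω c)) * rowSketch A (fun c => g (ω c)) -
      rowSketch A (fun c => g (ω c)) * A‖ ^ 2 ≤ 3 * ‖A‖ ^ 4 / Fintype.card κ := by
  have hcard : (0 : ℝ) < Fintype.card κ := Nat.cast_pos.2 Fintype.card_pos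
  have hS : ∀ a : κ, Fintype.card κ ≤ ({a}ᶜ : Finset κ).card + 3 := fun a => by
    rw [Finset.card_compl, Finset.card_singleton]
    omega
  simp_rw [frobenius_norm_sq_eq_sum_dotProduct, offDiagSketch_mul_rowSketch_sub_apply hA,
    smul_dotProduct, dotProduct_smul, smul_eq_mul, Finset.expect_sum_comm, ← Finset.mul_expect,
    ← mul_assoc, ← sq, inv_pow, mul_pow, Real.sq_sqrt hcard.le]
  calc ∑ a, ((Fintype.card κ : ℝ) ^ 2 * Fintype.card κ)⁻¹ *
        𝔼 ω : κ → R, (g (ω a) ᵥ* gramError A (fun c => g (ω c)) {a}ᶜ) ⬝ᵥ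
          (g (ω a) ᵥ* gramError A (fun c => g (ω c)) {a}ᶜ)
      ≤ ∑ _a : κ, ((Fintype.card κ : ℝ) ^ 2 * Fintype.card κ)⁻¹ *
        (3 * Fintype.card κ * ‖A‖ ^ 4) :=
        Finset.sum_le_sum fun a _ => mul_le_mul_of_nonneg_left
          (hg.expect_vecMul_gramError_le A (hS a) (by simp)) (by positivity)
    _ = 3 * ‖A‖ ^ 4 / Fintype.card κ := by
        rw [Finset.sum_const, Finset.card_univ, nsmul_eq_mul]
        field_simp

theorem expect_norm_sq_mul_transpose_sub_le (hg : IsotropicFamily g) {A : Matrix ι ι ℝ}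
    (hA : A.IsSymm) :
    𝔼 ω : κ → R, ‖rowSketch A (fun c => g (ω c)) * (rowSketch A fun c => g (ω c))ᵀ -
      offDiagSketch A (fun c => g (ω c)) * offDiagSketch A (fun c => g (ω c))‖ ^ 2 ≤
        9 * ‖A‖ ^ 4 / Fintype.card κ := by
  have hS : ∀ a b : κ, Fintype.card κ ≤ ({a, b}ᶜ : Finset κ).card + 3 := fun a b => by
    have hpair : ({a, b} : Finset κ).card ≤ 2 := Finset.card_le_two
    rw [Finset.card_compl]
    omega
  simp_rw [frobenius_norm_sq, rowSketch_mul_transpose_sub_apply hA, mul_pow,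
    Finset.expect_sum_comm, ← Finset.mul_expect, neg_sq, inv_pow]
  calc ∑ a, ∑ b, (((Fintype.card κ : ℝ) ^ 2) ^ 2)⁻¹ *
        𝔼 ω : κ → R, ((g (ω a) ᵥ* gramError A (fun c => g (ω c)) {a, b}ᶜ) ⬝ᵥ g (ω b)) ^ 2
      ≤ ∑ _a : κ, ∑ _b : κ, (((Fintype.card κ : ℝ) ^ 2) ^ 2)⁻¹ *
        (9 * Fintype.card κ * ‖A‖ ^ 4) :=
        Finset.sum_le_sum fun a _ => Finset.sum_le_sum fun b _ => mul_le_mul_of_nonneg_left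
          (hg.expect_bilin_gramError_sq_le A (hS a b) (by simp) (by simp)) (by positivity)
    _ = 9 * ‖A‖ ^ 4 / Fintype.card κ := by
        rw [Finset.sum_const, Finset.sum_const, Finset.card_univ, nsmul_eq_mul, nsmul_eq_mul]
        field_simp

theorem expect_sketchError_le (hg : IsotropicFamily g) {A : Matrix ι ι ℝ} (hA : A.IsSymm) :
    𝔼 ω : κ → R, sketchError A (fun c => g (ω c)) ≤ 15 * ‖A‖ ^ 4 / Fintype.card κ := by
  have hgram := hg.expect_norm_sq_transpose_mul_self_sub_le (κ := κ) A
  rw [hA.eq] at hgram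
  simp_rw [sketchError, Finset.expect_add_distrib]
  calc _ ≤ 3 * ‖A‖ ^ 4 / Fintype.card κ + 3 * ‖A‖ ^ 4 / Fintype.card κ
        + 9 * ‖A‖ ^ 4 / Fintype.card κ :=
        add_le_add (add_le_add hgram (hg.expect_norm_sq_mul_sub_mul_le hA))
          (hg.expect_norm_sq_mul_transpose_sub_le hA)
    _ = 15 * ‖A‖ ^ 4 / Fintype.card κ := by ring

end IsotropicFamily

end Sketch

section SignVectors

open scoped BigOperators

variable {ι : Type*}

/-- The vectors with entries `±1`, indexed by Boolean vectors. -/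
def signVector (r : ι → Bool) : ι → ℝ := fun i => if r i then 1 else -1

variable [Fintype ι] [DecidableEq ι]

theorem expect_sum_insert_signVector (φ : ℝ → ℝ) (u : ι → ℝ) {S : Finset ι} {c : ι} (hc : c ∉ S) :
    𝔼 r : ι → Bool, φ (∑ i ∈ insert c S, u i * signVector r i) =
      𝔼 r : ι → Bool, (φ (u c + ∑ i ∈ S, u i * signVector r i) +
        φ (-u c + ∑ i ∈ S, u i * signVector r i)) / 2 := by
  have hsum : ∀ (r : ι → Bool) s,
      ∑ i ∈ insert c S, u i * signVector (Function.update r c s) i =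
        u c * (if s then 1 else -1) + ∑ i ∈ S, u i * signVector r i := fun r s => by
    rw [Finset.sum_insert hc]
    congr 1
    · simp only [signVector, Function.update_self]
    · refine Finset.sum_congr rfl fun i hi => ?_
      simp only [signVector, Function.update_of_ne (ne_of_mem_of_not_mem hi hc)]
  rw [expect_resample c]
  refine Finset.expect_congr rfl fun r _ => ?_
  rw [Fintype.expect_eq_sum_div_card]
  simp [hsum]

theorem expect_sq_sum_signVector (u : ι → ℝ) (S : Finset ι) :
    𝔼 r : ι → Bool, (∑ i ∈ S, u i * signVector r i) ^ 2 = ∑ i ∈ S, u i ^ 2 := by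
  induction S using Finset.induction_on with
  | empty => simp
  | insert c S hc ih =>
    have hsq : ∀ t : ℝ, ((u c + t) ^ 2 + (-u c + t) ^ 2) / 2 = u c ^ 2 + t ^ 2 := fun t => by ring
    rw [expect_sum_insert_signVector (· ^ 2) u hc, Finset.sum_insert hc, ← ih]
    simp_rw [hsq, Finset.expect_add_distrib, Fintype.expect_const]

theorem expect_pow_four_sum_signVector_le (u : ι → ℝ) (S : Finset ι) :
    𝔼 r : ι → Bool, (∑ i ∈ S, u i * signVector r i) ^ 4 ≤ 3 * (∑ i ∈ S, u i ^ 2) ^ 2 := by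
  induction S using Finset.induction_on with
  | empty => simp
  | insert c S hc ih =>
    have hpow : ∀ t : ℝ, ((u c + t) ^ 4 + (-u c + t) ^ 4) / 2 =
        u c ^ 4 + 6 * u c ^ 2 * t ^ 2 + t ^ 4 := fun t => by ring
    rw [expect_sum_insert_signVector (· ^ 4) u hc, Finset.sum_insert hc]
    simp_rw [hpow, Finset.expect_add_distrib, ← Finset.mul_expect, expect_sq_sum_signVector,
      Fintype.expect_const]
    nlinarith [sq_nonneg (u c ^ 2)]

theorem isotropicFamily_signVector :
    IsotropicFamily (signVector : (ι → Bool) → ι → ℝ) where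
  expect_dotProduct_sq u := by
    simpa only [dotProduct, sq] using expect_sq_sum_signVector u Finset.univ
  expect_dotProduct_pow_four_le u := by
    simpa only [dotProduct, sq] using expect_pow_four_sum_signVector_le u Finset.univ

end SignVectors

section Markov

open scoped BigOperators

variable {Ω : Type*} [Fintype Ω] [MeasurableSpace Ω] [MeasurableSingletonClass Ω]

theorem uniformOn_univ_real_eq_expect (s : Set Ω) :
    (ProbabilityTheory.uniformOn Set.univ).real s = 𝔼 ω, s.indicator 1 ω := by
  classical
  have hcount : Measure.count s = s.toFinset.card := by
    rw [← Measure.count_apply_finset, Set.coe_toFinset]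
  rw [Measure.real, ProbabilityTheory.uniformOn_univ, hcount, Fintype.expect_eq_sum_div_card]
  simp [Set.indicator_apply, Set.toFinset_card, Fintype.card_subtype]

theorem one_sub_le_uniformOn_univ_real [Nonempty Ω] {X : Ω → ℝ} (hX : ∀ ω, 0 ≤ X ω) {θ p : ℝ}
    (hθ : 0 ≤ θ) (hp : 0 ≤ p) (h : 𝔼 ω, X ω ≤ p * θ) :
    1 - p ≤ (ProbabilityTheory.uniformOn Set.univ).real {ω | X ω ≤ θ} := by
  rw [uniformOn_univ_real_eq_expect]
  rcases hθ.eq_or_lt with rfl | hθ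
  · have hzero : 𝔼 ω, X ω = 0 :=
      le_antisymm (by simpa using h) (Finset.expect_nonneg fun ω _ => hX ω)
    have hX0 : X = 0 := (Fintype.expect_eq_zero_iff_of_nonneg hX).1 hzero
    simpa [hX0] using hp
  · calc 1 - p ≤ 1 - (𝔼 ω, X ω) / θ := by
          gcongr
          exact (div_le_iff₀ hθ).2 h
      _ = 𝔼 ω, (1 - X ω / θ) := by
          rw [Finset.expect_sub_distrib, Fintype.expect_const, Finset.expect_div]
      _ ≤ 𝔼 ω, {ω | X ω ≤ θ}.indicator 1 ω := by
          refine Finset.expect_le_expect fun ω _ => ?_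
          have hnonneg : 0 ≤ X ω / θ := div_nonneg (hX ω) hθ.le
          by_cases hω : X ω ≤ θ
          · simpa [hω] using hnonneg
          · simpa [hω] using ((one_lt_div hθ).2 (not_le.1 hω)).le

end Markov

section TopSelection

section SelectsLargest

variable {X α : Type*} {k : ℕ}

/-- The embedding `e` picks out indices at which `c` is largest in magnitude. -/
def SelectsLargest (c : X → ℝ) (e : α ↪ X) : Prop :=
  ∀ x ∉ Set.range e, ∀ i, |c x| ≤ |c (e i)|

theorem exists_selectsLargest [Fintype X] (hk : k ≤ Fintype.card X) (c : X → ℝ) :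
    ∃ e : Fin k ↪ X, SelectsLargest c e := by
  let φ := Fintype.equivFin X
  let f : Fin (Fintype.card X) → ℝ := fun j => -|c (φ.symm j)|
  have hsorted : Monotone (f ∘ Tuple.sort f) := Tuple.monotone_sort f
  refine ⟨(Fin.castLEEmb hk).trans ((Tuple.sort f).trans φ.symm).toEmbedding, fun x hx i => ?_⟩
  have hrank : k ≤ ((Tuple.sort f).symm (φ x) : ℕ) := by
    by_contra! h
    exact hx ⟨⟨_, h⟩, by simp⟩
  have hle : Fin.castLE hk i ≤ (Tuple.sort f).symm (φ x) := Fin.le_def.2 (i.2.le.trans hrank)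
  simpa [f] using hsorted hle

theorem exists_measurable_selection [Fintype X] (hk : k ≤ Fintype.card X) :
    ∃ sel : (X → ℝ) → Fin k → ℝ, Measurable sel ∧
      ∀ c, ∃ e : Fin k ↪ X, SelectsLargest c e ∧ sel c = c ∘ e := by
  classical
  have : Nonempty (Fin k ↪ X) := ⟨(exists_selectsLargest hk 0).choose⟩
  obtain ⟨enum, henum⟩ := exists_surjective_nat (Fin k ↪ X)
  have hex : ∀ c : X → ℝ, ∃ n, SelectsLargest c (enum n) := fun c =>
    henum.exists.1 (exists_selectsLargest hk c)
  refine ⟨fun c => c ∘ enum (Nat.find (hex c)), ?_, fun c => ⟨_, Nat.find_spec (hex c), rfl⟩⟩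
  refine Measurable.find (f := fun n (c : X → ℝ) => c ∘ enum n)
    (p := fun n c => SelectsLargest c (enum n)) (fun n => by fun_prop) (fun n => ?_) hex
  refine IsClosed.measurableSet ?_
  simp only [SelectsLargest, Set.ofPred_forall]
  exact isClosed_iInter fun x => isClosed_iInter fun _ => isClosed_iInter fun i =>
    isClosed_le (by fun_prop) (by fun_prop)

variable [Finite α]

theorem exists_perm_apply_eq_of_mem_range (e g : α ↪ X) :
    ∃ σ : Equiv.Perm α, ∀ i, g i ∈ Set.range e → e (σ i) = g i := by
  classical
  choose τ hτ using fun i : {i // g i ∈ Set.range e} => i.2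
  have hτ_inj : Function.Injective τ := fun i j hij =>
    Subtype.ext (g.injective ((hτ i).symm.trans ((congrArg e hij).trans (hτ j))))
  let τ' : {i // g i ∈ Set.range e} ≃ {j // j ∈ Set.range τ} := Equiv.ofInjective τ hτ_inj
  exact ⟨τ'.extendSubtype, fun i hi => by rw [τ'.extendSubtype_apply_of_mem i hi]; exact hτ ⟨i, hi⟩⟩

namespace SelectsLargest

variable {c : X → ℝ} {e : α ↪ X}

theorem le_abs_apply (he : SelectsLargest c e) {t : ℝ} (g : α ↪ X) (hg : ∀ i, t ≤ |c (g i)|)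
    (i : α) : t ≤ |c (e i)| := by
  obtain ⟨σ, hσ⟩ := exists_perm_apply_eq_of_mem_range e g
  by_cases hmem : g (σ.symm i) ∈ Set.range e
  · simpa only [← hσ _ hmem, Equiv.apply_symm_apply] using hg (σ.symm i)
  · exact (hg _).trans (he _ hmem i)

theorem mem_range (he : SelectsLargest c e) {y : X} {s : Finset X} (hs : s.card < Nat.card α)
    (h : ∀ x, |c y| ≤ |c x| → x ∈ s) : y ∈ Set.range e := by
  by_contra hy
  have := Fintype.ofFinite α
  have hsub : Finset.univ.map e ⊆ s := fun x hx => by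
    obtain ⟨i, -, rfl⟩ := Finset.mem_map.1 hx
    exact h _ (he y hy i)
  have hcard := Finset.card_le_card hsub
  rw [Finset.card_map, Finset.card_univ, ← Nat.card_eq_fintype_card] at hcard
  omega

end SelectsLargest

end SelectsLargest

section Accuracy

variable {X : Type*} {d k : ℕ} {lam : Fin d → ℝ} {f : Fin d ↪ X} {c : X → ℝ} {e : Fin k ↪ X}
  {η θ : ℝ}

theorem exists_abs_sub_le_of_selectsLargest (hk : 1 ≤ k) (hkd : k ≤ d)
    (hlam : Antitone fun i => |lam i|) (hc : ∀ x, |Function.extend f lam 0 x - c x| ≤ η)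
    (he : SelectsLargest c e) (hη : 3 * η ≤ θ) (i : Fin k) :
    ∃ j, |lam ⟨k - 1, by omega⟩| - θ ≤ |lam j| ∧ |c (e i) - lam j| ≤ θ := by
  have hη0 : 0 ≤ η := (abs_nonneg _).trans (hc (e i))
  have hclose : ∀ j, |c (f j) - lam j| ≤ η := fun j => by
    simpa only [f.injective.extend_apply, abs_sub_comm] using hc (f j)
  have htop : |lam ⟨k - 1, by omega⟩| - η ≤ |c (e i)| := by
    refine he.le_abs_apply ((Fin.castLEEmb hkd).trans f) (fun i' => ?_) i
    have hmono : |lam ⟨k - 1, by omega⟩| ≤ |lam (Fin.castLE hkd i')| :=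
      hlam (Fin.le_def.2 (Nat.le_sub_one_of_lt i'.isLt))
    have hi' := (abs_le.1 ((abs_abs_sub_abs_le _ _).trans (hclose (Fin.castLE hkd i')))).1
    change _ ≤ |c (f (Fin.castLE hkd i'))|
    linarith
  by_cases hmem : e i ∈ Set.range f
  · obtain ⟨j, hj⟩ := hmem
    have hij := hclose j
    rw [hj] at hij
    have := (abs_le.1 ((abs_abs_sub_abs_le _ _).trans hij)).2
    exact ⟨j, by linarith, by linarith⟩
  · have hsmall := hc (e i)
    rw [Function.extend_apply' _ _ _ hmem, Pi.zero_apply, zero_sub, abs_neg] at hsmall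
    refine ⟨⟨k - 1, by omega⟩, by linarith, (abs_sub _ _).trans (by linarith)⟩

theorem mem_range_of_selectsLargest (hk : 1 ≤ k) (hkd : k ≤ d) (hlam : Antitone fun i => |lam i|)
    (hc : ∀ x, |Function.extend f lam 0 x - c x| ≤ η) (he : SelectsLargest c e) {j : Fin d}
    (hj : |lam ⟨k - 1, by omega⟩| + 2 * η < |lam j|) : f j ∈ Set.range e := by
  have hdist := fun x => abs_le.1 ((abs_abs_sub_abs_le _ _).trans (hc x))
  refine he.mem_range (s := (Finset.Iio ⟨k - 1, by omega⟩).map f) ?_ fun x hx => ?_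
  · rw [Finset.card_map, Fin.card_Iio, Nat.card_fin]
    exact Nat.sub_lt hk one_pos
  · have hfj := (hdist (f j)).2
    rw [f.injective.extend_apply] at hfj
    have hlarge : |lam ⟨k - 1, by omega⟩| < |Function.extend f lam 0 x| := by
      linarith [(hdist x).1]
    have hmem : x ∈ Set.range f := by
      by_contra hx'
      rw [Function.extend_apply' _ _ _ hx', Pi.zero_apply, abs_zero] at hlarge
      exact hlarge.not_ge (abs_nonneg _)
    obtain ⟨j', rfl⟩ := hmem
    rw [f.injective.extend_apply] at hlarge
    exact Finset.mem_map_of_mem f (Finset.mem_Iio.2 (hlam.reflect_lt hlarge))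

theorem exists_perm_abs_sub_le_of_selectsLargest (hk : 1 ≤ k) (hkd : k ≤ d)
    (hlam : Antitone fun i => |lam i|) (hc : ∀ x, |Function.extend f lam 0 x - c x| ≤ η)
    (he : SelectsLargest c e) :
    ∃ σ : Equiv.Perm (Fin k), ∀ i,
      |lam ⟨k - 1, by omega⟩| + 2 * η < |lam (Fin.castLE hkd i)| →
        |c (e (σ i)) - lam (Fin.castLE hkd i)| ≤ η := by
  obtain ⟨σ, hσ⟩ := exists_perm_apply_eq_of_mem_range e ((Fin.castLEEmb hkd).trans f)
  refine ⟨σ, fun i hi => ?_⟩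
  rw [hσ i (mem_range_of_selectsLargest hk hkd hlam hc he hi), abs_sub_comm]
  simpa only [f.injective.extend_apply] using! hc (f (Fin.castLE hkd i))

theorem accurateTopEigenvalues_of_selectsLargest {ε F : ℝ} (hk : 1 ≤ k) (hkd : k ≤ d)
    (hlam : Antitone fun i => |lam i|) (hc : ∀ x, |Function.extend f lam 0 x - c x| ≤ η)
    (he : SelectsLargest c e) (hη : 3 * η ≤ ε * F) (hF : ε * F = 0 → lam = 0) :
    AccurateTopEigenvalues hk hkd ε F lam (c ∘ e) where
  separated := by
    have hη0 : 0 ≤ η := (abs_nonneg _).trans (hc (e ⟨0, hk⟩))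
    rcases (show 0 ≤ ε * F by linarith).eq_or_lt with hzero | hpos
    · have hlam0 := hF hzero.symm
      refine ⟨1, fun i _ => ?_⟩
      obtain ⟨j, -, hj⟩ := exists_abs_sub_le_of_selectsLargest hk hkd hlam hc he hη i
      simpa [hlam0] using hj
    · obtain ⟨σ, hσ⟩ := exists_perm_abs_sub_le_of_selectsLargest hk hkd hlam hc he
      exact ⟨σ, fun i hi => (hσ i (by linarith)).trans (by linarith)⟩
  sound := exists_abs_sub_le_of_selectsLargest hk hkd hlam hc he hη

end Accuracy

theorem exists_signedTerms_eq_extend {d n N : ℕ} (hN : n ≤ N) (l : Fin n → ℝ) (π : Fin d ≃ Fin n) :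
    ∃ f : Fin d ↪ Fin N ⊕ Fin N, signedTerms N l = Function.extend f (l ∘ π) 0 := by
  let pos : Fin n → Fin N ⊕ Fin N := fun i =>
    if 0 < l i then Sum.inl (Fin.castLE hN i) else Sum.inr (Fin.castLE hN i.rev)
  have hpos : Function.Injective pos := fun a b hab => by
    simp only [pos] at hab
    split_ifs at hab
    · exact Fin.castLE_injective hN (Sum.inl_injective hab)
    · exact Fin.rev_injective (Fin.castLE_injective hN (Sum.inr_injective hab))
  have happly : ∀ i, signedTerms N l (pos i) = l i := fun i => by
    rcases lt_or_ge 0 (l i) with hi | hi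
    · simp [pos, signedTerms, posTerm_val, hi, hi.le]
    · have hrev := posTerm_val (fun i => -l i.rev) i.rev
      rw [Fin.rev_rev, max_eq_left (neg_nonneg.2 hi)] at hrev
      simp only [pos, signedTerms, if_neg hi.not_gt, Sum.elim_inr, Fin.val_castLE, hrev, neg_neg]
  have hzero : ∀ x ∉ Set.range pos, signedTerms N l x = 0 := by
    rintro (j | j) hx
    · exact posTerm_eq_zero fun hj => not_lt.1 fun h => hx ⟨⟨j, hj⟩, if_pos h⟩
    · refine neg_eq_zero.2 (posTerm_eq_zero fun hj => neg_nonpos.2 (le_of_not_gt fun h => hx ?_))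
      refine ⟨Fin.rev ⟨j, hj⟩, (if_neg h.not_gt).trans ?_⟩
      rw [Fin.rev_rev, Fin.castLE_mk]
  refine ⟨π.toEmbedding.trans ⟨pos, hpos⟩, funext fun x => ?_⟩
  by_cases hx : ∃ i, pos (π i) = x
  · obtain ⟨i, rfl⟩ := hx
    rw [happly]
    exact ((hpos.comp π.injective).extend_apply (l ∘ π) 0 i).symm
  · rw [hzero x fun ⟨i, hi⟩ => hx ⟨π.symm i, by rw [π.apply_symm_apply, hi]⟩]
    exact (Function.extend_apply' (f := fun i => pos (π i)) (l ∘ π) (fun _ => 0) x hx).symm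

end TopSelection

section Algorithm

open scoped BigOperators Matrix.Norms.Frobenius

theorem continuous_signedTerms_eigenvalues₀ {T ι : Type*} [TopologicalSpace T] [Fintype ι]
    [DecidableEq ι] {B : T → Matrix ι ι ℝ} (hB : Continuous B) (hherm : ∀ t, (B t).IsHermitian)
    (N : ℕ) : Continuous fun t => signedTerms N (hherm t).eigenvalues₀ := by
  refine continuous_pi fun x => continuous_iff_continuousAt.2 fun t₀ => ?_
  have hdist : Filter.Tendsto (fun t => ‖B t - B t₀‖) (nhds t₀) (nhds 0) := by
    have hcont : Continuous fun t => ‖B t - B t₀‖ := (hB.sub continuous_const).norm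
    simpa only [sub_self, norm_zero] using hcont.tendsto t₀
  exact tendsto_iff_dist_tendsto_zero.2 (squeeze_zero (fun _ => dist_nonneg)
    (fun t => abs_signedTerms_eigenvalues₀_sub_le_norm (hherm t) (hherm t₀) x) hdist)

theorem dotProduct_mulVec_comm_of_isSymm {ι : Type*} [Fintype ι] {A : Matrix ι ι ℝ}
    (hA : A.IsSymm) (v w : ι → ℝ) : v ⬝ᵥ A *ᵥ w = w ⬝ᵥ A *ᵥ v := by
  rw [dotProduct_comm, Matrix.dotProduct_mulVec, ← Matrix.mulVec_transpose, hA.eq]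

theorem offDiagSketch_isHermitian {ι κ : Type*} [Fintype ι] [Fintype κ] [DecidableEq κ]
    {A : Matrix ι ι ℝ} (hA : A.IsSymm) (x : κ → ι → ℝ) : (offDiagSketch A x).IsHermitian := by
  ext a b
  simp only [offDiagSketch, Matrix.conjTranspose_apply, Matrix.of_apply, star_trivial,
    eq_comm (a := b), dotProduct_mulVec_comm_of_isSymm hA (x b)]

/-- The symmetric matrix with zero diagonal computed from the answers to the `M²` queries for all
pairs from a list of `M` vectors. Averaging the two answers for each unordered pair makes it
symmetric for arbitrary answers. -/
noncomputable def answerMatrix (M : ℕ) (ans : Fin (M * M) → ℝ) : Matrix (Fin M) (Fin M) ℝ :=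
  Matrix.of fun a b =>
    if a = b then 0 else (ans (finProdFinEquiv (a, b)) + ans (finProdFinEquiv (b, a))) / (2 * M)

theorem answerMatrix_isHermitian (M : ℕ) (ans : Fin (M * M) → ℝ) :
    (answerMatrix M ans).IsHermitian := by
  ext a b
  simp only [answerMatrix, Matrix.conjTranspose_apply, Matrix.of_apply, star_trivial,
    eq_comm (a := b), add_comm]

theorem continuous_answerMatrix (M : ℕ) : Continuous (answerMatrix M) := by
  refine continuous_matrix fun a b => ?_
  simp only [answerMatrix, Matrix.of_apply]
  split_ifs <;> fun_prop

theorem answerMatrix_vmvAnswer {d M : ℕ} {A : Matrix (Fin d) (Fin d) ℝ} (hA : A.IsSymm)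
    (x : Fin M → Fin d → ℝ) :
    (answerMatrix M fun j => vmvAnswer A (x (finProdFinEquiv.symm j).1)
      (x (finProdFinEquiv.symm j).2)) = offDiagSketch A x := by
  ext a b
  simp only [answerMatrix, offDiagSketch, Matrix.of_apply, vmvAnswer, Equiv.symm_apply_apply,
    dotProduct_mulVec_comm_of_isSymm hA (x b), Fintype.card_fin, ← two_mul,
    mul_div_mul_left _ _ (two_ne_zero' ℝ)]

/-- The algorithm that queries all pairs from `M` independent uniform sign vectors and applies `sel`
to the positive and negative eigenvalues of the resulting matrix. -/
noncomputable def signVectorAlgorithm {d k : ℕ} (M : ℕ) (sel : (Fin d ⊕ Fin d → ℝ) → Fin k → ℝ)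
    (hsel : Measurable sel) : NonadaptiveVMV d k (M * M) where
  Seed := Fin M → Fin d → Bool
  law := ProbabilityTheory.uniformOn Set.univ
  instIsProbabilityMeasure :=
    ProbabilityTheory.isProbabilityMeasure_uniformOn Set.finite_univ Set.univ_nonempty
  left s j := signVector (s (finProdFinEquiv.symm j).1)
  right s j := signVector (s (finProdFinEquiv.symm j).2)
  output p := sel (signedTerms d (answerMatrix_isHermitian M p.2).eigenvalues₀)
  measurable_left := measurable_of_finite _
  measurable_right := measurable_of_finite _
  measurable_output := hsel.comp <| (continuous_signedTerms_eigenvalues₀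
    (continuous_answerMatrix M) (answerMatrix_isHermitian M) d).measurable.comp measurable_snd

variable {d k : ℕ} {A : Matrix (Fin d) (Fin d) ℝ}

theorem signVectorAlgorithm_run {M : ℕ} {sel : (Fin d ⊕ Fin d → ℝ) → Fin k → ℝ}
    (hsel : Measurable sel) (hA : A.IsSymm) (s : Fin M → Fin d → Bool) :
    (signVectorAlgorithm M sel hsel).run A s =
      sel (signedTerms d
        (offDiagSketch_isHermitian hA fun c => signVector (s c)).eigenvalues₀) := by
  have hcongr : ∀ {B B' : Matrix (Fin M) (Fin M) ℝ} (hB : B.IsHermitian) (hB' : B'.IsHermitian),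
      B = B' → signedTerms d hB.eigenvalues₀ = signedTerms d hB'.eigenvalues₀ := by
    rintro B _ _ _ rfl
    rfl
  exact congrArg sel (hcongr _ _ (answerMatrix_vmvAnswer hA fun c => signVector (s c)))

theorem IsSpectrumByMagnitude.exists_signedTerms_eq_extend {hA : A.IsHermitian} {lam : Fin d → ℝ}
    (hlam : IsSpectrumByMagnitude hA lam) :
    ∃ f : Fin d ↪ Fin d ⊕ Fin d, signedTerms d hA.eigenvalues₀ = Function.extend f lam 0 := by
  obtain ⟨p, rfl⟩ := hlam.enumerates
  exact _root_.exists_signedTerms_eq_extend (Fintype.card_fin d).le hA.eigenvalues₀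
    (p.trans (Fintype.equivOfCardEq (Fintype.card_fin _)).symm)

theorem IsSpectrumByMagnitude.eq_zero_of_eq_zero {hA : A.IsHermitian} {lam : Fin d → ℝ}
    (hlam : IsSpectrumByMagnitude hA lam) (h : A = 0) : lam = 0 := by
  obtain ⟨p, rfl⟩ := hlam.enumerates
  rw [hA.eigenvalues_eq_zero_iff.2 h]
  rfl

theorem accurateTopEigenvalues_of_sketchError_le {κ : Type*} [Fintype κ] [DecidableEq κ]
    (hk : 1 ≤ k) (hkd : k ≤ d) {ε : ℝ} (hε : 0 < ε) {hA : A.IsHermitian} {lam : Fin d → ℝ}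
    (hlam : IsSpectrumByMagnitude hA lam) {x : κ → Fin d → ℝ}
    (hx : sketchError A x ≤ (ε * ‖A‖ / 6) ^ 4) (hH : (offDiagSketch A x).IsHermitian)
    {e : Fin k ↪ Fin d ⊕ Fin d} (he : SelectsLargest (signedTerms d hH.eigenvalues₀) e) :
    AccurateTopEigenvalues hk hkd ε ‖A‖ lam (signedTerms d hH.eigenvalues₀ ∘ e) := by
  obtain ⟨δ, hδ⟩ : ∃ δ, δ = ε * ‖A‖ / 6 := ⟨_, rfl⟩
  have hδ0 : 0 ≤ δ := hδ ▸ by positivity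
  have hle : ∀ t : ℝ, t ^ 2 ≤ sketchError A x → t ≤ δ ^ 2 := fun t ht =>
    le_of_sq_le_sq (by rw [← pow_mul, hδ]; exact ht.trans hx) (by positivity)
  obtain ⟨f, hf⟩ := hlam.exists_signedTerms_eq_extend
  refine accurateTopEigenvalues_of_selectsLargest (f := f) (η := 2 * δ) hk hkd hlam.antitone_abs
    (fun y => ?_) he (by rw [hδ]; linarith) fun h => ?_
  · rw [← hf]
    exact abs_signedTerms_eigenvalues₀_sub_le hA hH (rowSketch A x) hδ0
      (hle _ (norm_sq_transpose_mul_self_sub_le_sketchError A x))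
      (hle _ (norm_sq_mul_sub_mul_le_sketchError A x))
      (hle _ (norm_sq_mul_transpose_sub_le_sketchError A x)) y
  · exact hlam.eq_zero_of_eq_zero (norm_eq_zero.1 ((mul_eq_zero.1 h).resolve_left hε.ne'))

theorem signVectorAlgorithm_approximatesTopEigenvalues (hk : 1 ≤ k) (hkd : k ≤ d) {ε : ℝ}
    (hε : 0 < ε) {M : ℕ} (hM : 194400 / ε ^ 4 ≤ M) {sel : (Fin d ⊕ Fin d → ℝ) → Fin k → ℝ}
    (hsel : Measurable sel) (hlargest : ∀ c, ∃ e : Fin k ↪ Fin d ⊕ Fin d,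
      SelectsLargest c e ∧ sel c = c ∘ e) :
    (signVectorAlgorithm M sel hsel).ApproximatesTopEigenvalues hk hkd ε := by
  intro A hA lam hlam
  have hAs := Matrix.isHermitian_iff_isSymm.1 hA
  have hM0 : (0 : ℝ) < M := lt_of_lt_of_le (by positivity) hM
  have : NeZero M := ⟨fun h => hM0.ne' (by rw [h, Nat.cast_zero])⟩
  -- `194400 = 10 * 15 * 6 ^ 4`: failure probability, total expected error, and `δ = ε * ‖A‖ / 6`.
  have hexpect : 𝔼 s : Fin M → Fin d → Bool, sketchError A (fun c => signVector (s c)) ≤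
      1 / 10 * (ε * ‖A‖ / 6) ^ 4 := by
    refine (isotropicFamily_signVector.expect_sketchError_le hAs).trans ?_
    rw [Fintype.card_fin, div_le_iff₀ hM0]
    calc 15 * ‖A‖ ^ 4 = ‖A‖ ^ 4 * 194400 / 12960 := by ring
      _ ≤ ‖A‖ ^ 4 * (M * ε ^ 4) / 12960 := by
        gcongr
        exact (div_le_iff₀ (by positivity)).1 hM
      _ = 1 / 10 * (ε * ‖A‖ / 6) ^ 4 * M := by ring
  have hmarkov := one_sub_le_uniformOn_univ_real (fun s => sketchError_nonneg A _) (by positivity)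
    (by norm_num) hexpect
  refine (by norm_num : (9 / 10 : ℝ) ≤ 1 - 1 / 10).trans (hmarkov.trans ?_)
  refine measureReal_mono (μ := ProbabilityTheory.uniformOn Set.univ) fun s hs => ?_
  obtain ⟨e, he, hsel_eq⟩ := hlargest
    (signedTerms d (offDiagSketch_isHermitian hAs fun c => signVector (s c)).eigenvalues₀)
  change AccurateTopEigenvalues hk hkd ε ‖A‖ lam ((signVectorAlgorithm M sel hsel).run A s)
  rw [signVectorAlgorithm_run hsel hAs, hsel_eq]
  exact accurateTopEigenvalues_of_sketchError_le hk hkd hε hlam hs _ he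

/-- A non-adaptive algorithm, viewed as a two-round algorithm without a second round. -/
noncomputable def NonadaptiveVMV.toTwoRound {d k q : ℕ} (alg : NonadaptiveVMV d k q) :
    TwoRoundVMV d k q 0 :=
  letI := alg.instMeasurableSpace
  { Seed := alg.Seed
    instMeasurableSpace := alg.instMeasurableSpace
    law := alg.law
    instIsProbabilityMeasure := alg.instIsProbabilityMeasure
    left₁ := alg.left
    right₁ := alg.right
    left₂ := fun _ => Fin.elim0
    right₂ := fun _ => Fin.elim0
    output := fun p => alg.output (p.1, p.2.1)
    measurable_left₁ := alg.measurable_left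
    measurable_right₁ := alg.measurable_right
    measurable_left₂ := measurable_const
    measurable_right₂ := measurable_const
    measurable_output := alg.measurable_output.comp
      (measurable_fst.prodMk (measurable_fst.comp measurable_snd)) }

theorem NonadaptiveVMV.ApproximatesTopEigenvalues.toTwoRound {d k q : ℕ}
    {alg : NonadaptiveVMV d k q} {hk : 1 ≤ k} {hkd : k ≤ d} {ε : ℝ}
    (h : alg.ApproximatesTopEigenvalues hk hkd ε) :
    alg.toTwoRound.ApproximatesTopEigenvalues hk hkd ε :=
  h

end Algorithm

theorem mainTheorem11_general :
    ∃ C : ℝ, 0 < C ∧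
      ∀ (d k : ℕ) (hk : 1 ≤ k) (hkd : k ≤ d) (ε : ℝ), 0 < ε → ε ≤ 1 →
        ∃ (q : ℕ) (alg : NonadaptiveVMV d k q),
          (q : ℝ) ≤ C / ε ^ 8 ∧ alg.ApproximatesTopEigenvalues hk hkd ε := by
  refine ⟨(2 * 194400) ^ 2, by norm_num, fun d k hk hkd ε hε hε1 => ?_⟩
  obtain ⟨sel, hsel, hlargest⟩ := exists_measurable_selection (X := Fin d ⊕ Fin d) (k := k)
    (by rw [Fintype.card_sum, Fintype.card_fin]; omega)
  have hone : 1 ≤ 194400 / ε ^ 4 :=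
    (one_le_div (by positivity)).2 ((pow_le_one₀ hε.le hε1).trans (by norm_num))
  refine ⟨_, signVectorAlgorithm ⌈194400 / ε ^ 4⌉₊ sel hsel, ?_,
    signVectorAlgorithm_approximatesTopEigenvalues hk hkd hε (Nat.le_ceil _) hsel hlargest⟩
  calc ((⌈194400 / ε ^ 4⌉₊ * ⌈194400 / ε ^ 4⌉₊ : ℕ) : ℝ)
      = (⌈194400 / ε ^ 4⌉₊ : ℝ) ^ 2 := by rw [Nat.cast_mul, sq]
    _ ≤ (2 * (194400 / ε ^ 4)) ^ 2 := by
      gcongr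
      linarith [Nat.ceil_lt_add_one (zero_le_one.trans hone)]
    _ = (2 * 194400) ^ 2 / ε ^ 8 := by ring

theorem div_pow_le_two_mul_sq_mul_log {C ε : ℝ} {k m n : ℕ} (hC : 0 ≤ C) (hk : 1 ≤ k)
    (hε : 0 < ε) (hε1 : ε ≤ 1) (hmn : m ≤ n) :
    C / ε ^ m ≤ 2 * C * ((k : ℝ) ^ 2 / ε ^ n * Real.log ((k : ℝ) + 1)) := by
  have hk1 : (1 : ℝ) ≤ k := mod_cast hk
  have hk2 : (1 : ℝ) ≤ (k : ℝ) ^ 2 := one_le_pow₀ hk1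
  have hlog : 1 / 2 ≤ Real.log ((k : ℝ) + 1) :=
    (by linarith [Real.log_two_gt_d9] : 1 / 2 ≤ Real.log 2).trans
      (Real.log_le_log two_pos (by linarith))
  calc C / ε ^ m ≤ C / ε ^ n :=
        div_le_div_of_nonneg_left hC (by positivity) (pow_le_pow_of_le_one hε.le hε1 hmn)
    _ = 2 * C * (1 / ε ^ n * (1 / 2)) := by ring
    _ ≤ 2 * C * ((k : ℝ) ^ 2 / ε ^ n * Real.log ((k : ℝ) + 1)) := by gcongr

theorem mainTheorem11 :
    ∃ C : ℝ, 0 < C ∧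
      ∀ (d k : ℕ) (hk : 1 ≤ k) (hkd : k ≤ d) (ε : ℝ), 0 < ε → ε < 1 →
        (∃ (q : ℕ) (alg : NonadaptiveVMV d k q),
          (q : ℝ) ≤ C * ((k : ℝ) ^ 2 / ε ^ 12 * Real.log ((k : ℝ) + 1)) ∧
            alg.ApproximatesTopEigenvalues hk hkd ε) ∧
        (∃ (q₁ q₂ : ℕ) (alg : TwoRoundVMV d k q₁ q₂),
          (q₁ : ℝ) + (q₂ : ℝ) ≤ C * ((k : ℝ) ^ 2 / ε ^ 8 * Real.log ((k : ℝ) + 1)) ∧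
            alg.ApproximatesTopEigenvalues hk hkd ε) := by
  obtain ⟨C, hC, hgeneral⟩ := mainTheorem11_general
  refine ⟨2 * C, by positivity, fun d k hk hkd ε hε hε1 => ?_⟩
  obtain ⟨q, alg, hq, halg⟩ := hgeneral d k hk hkd ε hε hε1.le
  have hbound := fun n hn => hq.trans
    (div_pow_le_two_mul_sq_mul_log (n := n) hC.le hk hε hε1.le hn)
  exact ⟨⟨q, alg, hbound 12 (by norm_num), halg⟩, q, 0, alg.toTwoRound,
    by simpa only [Nat.cast_zero, add_zero] using hbound 8 le_rfl, halg.toTwoRound⟩
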